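/- Let $n\ge 1$ and let $K\subset\mathbb R^n$ be a convex body (a compact convex set) containing the origin in its interior. Write $\|x\|_L=\inf\{t>0: x\in tL\}$ for the Minkowski functional of a set $L$, $V$ for volume and $h_K(v)=\max_{z\in K}\langle z,v\rangle$. Let $S(K,\cdot)$ be the surface area measure of $K$, i.e. the push-forward of the $(n-1)$-dimensional Hausdorff measure on $\partial K$ under the (almost everywhere defined) outer unit normal map, and let $dS_2(K,\cdot)=h_K^{-1}\,dS(K,\cdot)$ be the $L_2$ surface area measure. The LYZ ellipsoid $\Gamma_{-2}K$ is the star-shaped set with radial function $\rho_{\Gamma_{-2}K}$ given by $$\rho_{\Gamma_{-2}K}(u)^{-2}=\frac1{V(K)}\int_{S^{n-1}}|\langle u,v\rangle|^2\,dS_2(K,v),\qquad u\in S^{n-1}.$$ For an integrable log-concave function $f$ on $\mathbb R^n$ put $J(f)=\int_{\mathbb R^n} f\,dx$ and $h_f(y)=\sup_{z}\{\langle y,z\rangle+\log f(z)\}$, and let $\mu_f$ be the push-forward of the measure $f\,dx$ under $\nabla(-\log f)$. The functional LYZ ellipsoid $\Gamma_{-2}f$ is defined by $$-\log\Gamma_{-2}f(x)=\frac{n}{4J(f)}\int_{\mathbb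 R^n}|\langle x,y\rangle|^2\,h_f(y)^{-1}\,d\mu_f(y).$$ If $f(x)=e^{-\|x\|_K^2/2}$, then $f$ is integrable with $J(f)>0$, all the integrals above converge, the integral defining $\rho_{\Gamma_{-2}K}(u)$ is positive for every $u\in S^{n-1}$, and $$\Gamma_{-2}f(x)=e^{-\|x\|_{\Gamma_{-2}K}^2/2}\qquad\text{for all }x\in\mathbb R^n.$$ -/

import Mathlib

open MeasureTheory Set
open scoped RealInnerProductSpace

namespace LYZ

/-! ### Convex bodies: support function, surface area measures, the LYZ ellipsoid -/

section Body

variable {n : ℕ}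

/-- The radial function `ρ_L(x) = sup {t ≥ 0 : t x ∈ L}`. -/
noncomputable def radialFunction (L : Set (EuclideanSpace ℝ (Fin n)))
    (x : EuclideanSpace ℝ (Fin n)) : ℝ :=
  sSup {t : ℝ | 0 ≤ t ∧ t • x ∈ L}

/-- The support function `h_K(v) = sup {⟨z, v⟩ : z ∈ K}` of a convex body. -/
noncomputable def bodySupport (K : ConvexBody (EuclideanSpace ℝ (Fin n)))
    (v : EuclideanSpace ℝ (Fin n)) : ℝ :=
  sSup ((fun z => ⟪z, v⟫) '' (K : Set (EuclideanSpace ℝ (Fin n))))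

/-- `v` is an outer unit normal vector of `K` at its point `z`. -/
def IsOuterUnitNormal (K : ConvexBody (EuclideanSpace ℝ (Fin n)))
    (z v : EuclideanSpace ℝ (Fin n)) : Prop :=
  ‖v‖ = 1 ∧ ∀ y ∈ K, ⟪y, v⟫ ≤ ⟪z, v⟫

/-- The regular boundary points of `K`: those with exactly one outer unit normal. -/
def regularBoundary (K : ConvexBody (EuclideanSpace ℝ (Fin n))) :
    Set (EuclideanSpace ℝ (Fin n)) :=
  {z | z ∈ frontier (K : Set (EuclideanSpace ℝ (Fin n))) ∧ ∃! v, IsOuterUnitNormal K z v}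

open Classical in
/-- The Gauss map `ν_K`, sending a regular boundary point to its outer unit normal (the value
elsewhere is irrelevant). -/
noncomputable def gaussMap (K : ConvexBody (EuclideanSpace ℝ (Fin n)))
    (z : EuclideanSpace ℝ (Fin n)) : EuclideanSpace ℝ (Fin n) :=
  if h : ∃ v, IsOuterUnitNormal K z v then h.choose else 0

/-- The surface area measure `S(K, ω) = H^{n-1}(ν_K⁻¹(ω))`, as a measure on `ℝⁿ` carried by the
unit sphere. Here `μHE[n - 1]` is the `(n-1)`-dimensional Hausdorff measure, normalized to agree
with Lebesgue measure on `(n-1)`-dimensional subspaces. -/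
noncomputable def surfaceAreaMeasure (K : ConvexBody (EuclideanSpace ℝ (Fin n))) :
    Measure (EuclideanSpace ℝ (Fin n)) :=
  Measure.map (gaussMap K) (μHE[n - 1].restrict (regularBoundary K))

/-- The `L₂` surface area measure: `dS₂(K, ·) = h_K⁻¹ dS(K, ·)`. -/
noncomputable def surfaceAreaMeasureTwo (K : ConvexBody (EuclideanSpace ℝ (Fin n))) :
    Measure (EuclideanSpace ℝ (Fin n)) :=
  (surfaceAreaMeasure K).withDensity fun v => ENNReal.ofReal (bodySupport K v)⁻¹

/-- `ρ_{Γ₋₂K}(u)`, given by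
`ρ_{Γ₋₂K}(u)⁻² = V(K)⁻¹ ∫_{S^{n-1}} |⟨u, v⟩|² dS₂(K, v)`. -/
noncomputable def lyzRadial (K : ConvexBody (EuclideanSpace ℝ (Fin n)))
    (u : EuclideanSpace ℝ (Fin n)) : ℝ :=
  (√(1 / volume.real (K : Set (EuclideanSpace ℝ (Fin n))) *
    ∫ v in Metric.sphere 0 1, |⟪u, v⟫| ^ 2 ∂(surfaceAreaMeasureTwo K)))⁻¹

/-- The LYZ ellipsoid `Γ₋₂K`: the set, star-shaped about the origin, whose radial function on the
unit sphere is `lyzRadial K` (see `radialFunction_lyzEllipsoid`). -/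
def lyzEllipsoid (K : ConvexBody (EuclideanSpace ℝ (Fin n))) :
    Set (EuclideanSpace ℝ (Fin n)) :=
  {x | ∃ u ∈ Metric.sphere (0 : EuclideanSpace ℝ (Fin n)) 1, ∃ t : ℝ,
    0 ≤ t ∧ t ≤ lyzRadial K u ∧ x = t • u}

theorem lyzRadial_nonneg (K : ConvexBody (EuclideanSpace ℝ (Fin n)))
    (u : EuclideanSpace ℝ (Fin n)) : 0 ≤ lyzRadial K u :=
  inv_nonneg.2 (Real.sqrt_nonneg _)

theorem radialFunction_lyzEllipsoid (K : ConvexBody (EuclideanSpace ℝ (Fin n)))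
    (u : EuclideanSpace ℝ (Fin n)) (hu : ‖u‖ = 1) :
    radialFunction (lyzEllipsoid K) u = lyzRadial K u := by
  have h : {t : ℝ | 0 ≤ t ∧ t • u ∈ lyzEllipsoid K} = Icc 0 (lyzRadial K u) := by
    ext t
    constructor
    · rintro ⟨ht, w, hw, s, hs, hsw, h⟩
      have hw1 : ‖w‖ = 1 := by simpa using hw
      have hts : t = s := by
        have := congrArg norm h
        simpa [norm_smul, hu, hw1, abs_of_nonneg ht, abs_of_nonneg hs] using this
      subst hts
      rcases hs.eq_or_lt with h0 | h0
      · exact ⟨ht, h0 ▸ lyzRadial_nonneg K u⟩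
      · have huw : u = w := smul_right_injective _ h0.ne' h
        exact ⟨ht, huw ▸ hsw⟩
    · rintro ⟨h0, h1⟩
      exact ⟨h0, u, by simpa using hu, t, h0, h1, rfl⟩
  rw [radialFunction, h, csSup_Icc (lyzRadial_nonneg K u)]

end Body

/-! ### Log-concave functions: support function, surface area measure, functional LYZ ellipsoid -/

section Functional

variable {n : ℕ}

/-- The support function `h_f(x) = sup_y (⟨x, y⟩ + log f(y))` of a function `f ≥ 0`, with values
in `[-∞, ∞]` and `log 0 = -∞`. -/
noncomputable def functionSupport (f : EuclideanSpace ℝ (Fin n) → ℝ)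
    (x : EuclideanSpace ℝ (Fin n)) : EReal :=
  ⨆ y, ((⟪x, y⟫ : ℝ) : EReal) + ENNReal.log (ENNReal.ofReal (f y))

/-- The surface area measure of `f`: the push-forward of the measure `f dx` under the (almost
everywhere defined) map `∇(-log f)`. -/
noncomputable def functionSurfaceMeasure (f : EuclideanSpace ℝ (Fin n) → ℝ) :
    Measure (EuclideanSpace ℝ (Fin n)) :=
  Measure.map (gradient fun y => -Real.log (f y))
    (volume.withDensity fun y => ENNReal.ofReal (f y))

/-- The total mass `J(f) = ∫ f dx`. -/
noncomputable def totalMass (f : EuclideanSpace ℝ (Fin n) → ℝ) : ℝ :=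
  ∫ y, f y

/-- The integrand `y ↦ |⟨x, y⟩|² h_f(y)⁻¹`, with `1 / ∞ = 0`. -/
noncomputable def lyzIntegrand (f : EuclideanSpace ℝ (Fin n) → ℝ)
    (x y : EuclideanSpace ℝ (Fin n)) : ℝ :=
  |⟪x, y⟫| ^ 2 * ((functionSupport f y)⁻¹).toReal

/-- The functional LYZ ellipsoid `Γ₋₂f`:
`-log Γ₋₂f(x) = n / (4 J(f)) ∫ |⟨x, y⟩|² h_f(y)⁻¹ dμ_f(y)`. -/
noncomputable def functionalLYZ (f : EuclideanSpace ℝ (Fin n) → ℝ)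
    (x : EuclideanSpace ℝ (Fin n)) : ℝ :=
  Real.exp (-((n : ℝ) / (4 * totalMass f) * ∫ y, lyzIntegrand f x y ∂(functionSurfaceMeasure f)))

end Functional

end LYZ

/-! Write g for the gauge of K, ν(z) for the normal at a regular boundary point z, and h for the
support function of K. Where g is differentiable, hence almost everywhere, ∇(g²/2)(x) = g(x) ν/h(ν)
with ν taken at the radial projection of x (`gradient_neg_log`). The Legendre transform of g²/2 at
this gradient is g(x)²/2 (`functionSupport_gradient`). The factors g(x)² therefore cancel, and the
functional integrand becomes the 0-homogeneous function 2⟨u,ν⟩²/h(ν)² (`lyzIntegrand_gradient`).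

Integrating a 0-homogeneous function against exp(-g²/2) gives a constant `gaussianMoment n` times
its integral over K (`lintegral_exp_gauge_mul`). The same constant appears in J(f) and drops out.
What remains is an integral over K, which equals an integral over the boundary because n times the
volume of the cone over a boundary piece is the integral of h(ν) with respect to H^{n-1}
(`coneMeasure_restrict_regularBoundary`). The density h turns h⁻² into the h⁻¹ of the L₂ surface
area measure.

The cone formula is the main work. Near a regular point the boundary is almost a piece of a
hyperplane, and flattening it distorts volume and Hausdorff measure by factors close to 1
(`exists_local_estimate`). For an exact flat cone the formula is Cavalieri's principle
(`volume_flatCone`). A countable covering makes the comparison global, and the factors are then sent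
to 1. -/

namespace LYZ

/-! ### Volume of cones with a flat base -/

section FlatCone

variable {n : ℕ}

local notation "𝔼" => EuclideanSpace ℝ (Fin n)

-- Points r(b + cv) have height rc in the direction v, so the height s forces r = s/c. Leaving out
-- the apex r = 0 makes the slice empty at every height outside (0, c].
open scoped Pointwise in
theorem slice_flatCone {v : 𝔼} (hv : ‖v‖ = 1) {c : ℝ} (hc : 0 < c) {B : Set 𝔼}
    (hB : ∀ b ∈ B, ⟪v, b⟫ = 0) (s : ℝ) :
    {x | ∃ r ∈ Ioc (0 : ℝ) 1, ∃ b ∈ B, x = r • (b + c • v)} ∩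
        AffineSubspace.mk' (s • v +ᵥ (0 : 𝔼)) (ℝ ∙ v)ᗮ =
      if s ∈ Ioc 0 c then (fun x => s • v + x) '' ((s / c) • B) else ∅ := by
  have hmem : ∀ x : 𝔼, x ∈ (AffineSubspace.mk' (s • v +ᵥ (0 : 𝔼)) (ℝ ∙ v)ᗮ : Set 𝔼) ↔
      ⟪v, x⟫ = s := by
    intro x
    rw [SetLike.mem_coe, AffineSubspace.mem_mk', Submodule.mem_orthogonal_singleton_iff_inner_right]
    simp [inner_sub_right, inner_smul_right, hv, sub_eq_zero]
  have hin : ∀ r : ℝ, ∀ b ∈ B, ⟪v, r • (b + c • v)⟫ = r * c := by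
    intro r b hb
    simp [inner_smul_right, inner_add_right, hB b hb, hv]
  split_ifs with hs
  · ext x
    rw [mem_inter_iff, hmem]
    constructor
    · rintro ⟨⟨r, hr, b, hb, rfl⟩, hx⟩
      rw [hin r b hb] at hx
      refine ⟨r • b, ⟨b, hb, ?_⟩, ?_⟩
      · simp [← hx, hc.ne']
      · simp [← hx, smul_smul, add_comm]
    · rintro ⟨_, ⟨b, hb, rfl⟩, rfl⟩
      have hx : s • v + (s / c) • b = (s / c) • (b + c • v) := by
        rw [smul_add, smul_smul, div_mul_cancel₀ _ hc.ne', add_comm]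
      refine ⟨⟨s / c, ⟨div_pos hs.1 hc, (div_le_one hc).2 hs.2⟩, b, hb, hx⟩, ?_⟩
      simp only [hx]
      rw [hin _ b hb, div_mul_cancel₀ _ hc.ne']
  · rw [eq_empty_iff_forall_notMem]
    rintro x ⟨⟨r, hr, b, hb, rfl⟩, hx⟩
    rw [hmem, hin r b hb] at hx
    refine hs ⟨hx ▸ mul_pos hr.1 hc, ?_⟩
    nlinarith [hr.2]

open scoped Pointwise in
/-- The volume of a cone over a subset of a hyperplane at distance `c` from the apex. -/
theorem volume_flatCone (hn : 1 ≤ n) {v : 𝔼} (hv : ‖v‖ = 1) {c : ℝ} (hc : 0 < c) {B : Set 𝔼}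
    (hB : ∀ b ∈ B, ⟪v, b⟫ = 0)
    (hF : MeasurableSet {x | ∃ r ∈ Ioc (0 : ℝ) 1, ∃ b ∈ B, x = r • (b + c • v)}) :
    (n : ENNReal) * volume {x | ∃ r ∈ Ioc (0 : ℝ) 1, ∃ b ∈ B, x = r • (b + c • v)} =
      ENNReal.ofReal c * μHE[n - 1] B := by
  have hv0 : v ≠ 0 := by
    rintro rfl
    simp at hv
  -- Cavalieri along v: the slice at height s has measure (s/c)^{n-1} H^{n-1}(B), and the integral
  -- of (s/c)^{n-1} over (0, c] is c/n.
  have key := EuclideanGeometry.euclideanHausdorffMeasure_eq_lintegral (0 : 𝔼) hv0 hF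
  rw [finrank_euclideanSpace_fin, EuclideanSpace.euclideanHausdorffMeasure_eq_volume] at key
  have hslice : ∀ s : ℝ, μHE[n - 1]
      ({x | ∃ r ∈ Ioc (0 : ℝ) 1, ∃ b ∈ B, x = r • (b + c • v)} ∩
        AffineSubspace.mk' (s • v +ᵥ (0 : 𝔼)) (ℝ ∙ v)ᗮ) =
      (Ioc 0 c).indicator (fun s => ENNReal.ofReal ((s / c) ^ (n - 1)) * μHE[n - 1] B) s := by
    intro s
    rw [slice_flatCone hv hc hB]
    by_cases hs : s ∈ Ioc 0 c
    · have hsc : 0 < s / c := div_pos hs.1 hc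
      rw [if_pos hs, indicator_of_mem hs,
        (isometry_add_left (s • v)).euclideanHausdorffMeasure_image,
        Measure.euclideanHausdorffMeasure_smul₀ _ hsc.ne', ENNReal.ofReal_pow hsc.le]
      rw [ENNReal.smul_def, smul_eq_mul, ENNReal.coe_pow, Real.nnnorm_of_nonneg hsc.le,
        ENNReal.ofReal_eq_coe_nnreal hsc.le]
    · rw [if_neg hs, indicator_of_notMem hs, measure_empty]
  have hint : ∫⁻ s in Ioc 0 c, ENNReal.ofReal ((s / c) ^ (n - 1)) = ENNReal.ofReal (c / n) := by
    rw [← ofReal_integral_eq_lintegral_ofReal]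
    · rw [← intervalIntegral.integral_of_le hc.le]
      simp_rw [div_pow]
      rw [intervalIntegral.integral_div, integral_pow]
      congr 1
      have h1 : n - 1 + 1 = n := by omega
      have h2 : ((n - 1 : ℕ) : ℝ) + 1 = n := by exact_mod_cast h1
      rw [h1, h2, zero_pow (by omega), sub_zero]
      have h3 : c ^ n = c ^ (n - 1) * c := by rw [← pow_succ, h1]
      rw [h3]
      field_simp
    · exact (by fun_prop : Continuous fun s : ℝ => (s / c) ^ (n - 1)).integrableOn_Icc.mono_set
        Ioc_subset_Icc_self
    · filter_upwards [ae_restrict_mem measurableSet_Ioc] with s hs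
      exact pow_nonneg (div_nonneg hs.1.le hc.le) _
  simp_rw [hslice] at key
  rw [lintegral_indicator measurableSet_Ioc, lintegral_mul_const _ (by fun_prop), hint] at key
  have hn0 : (0 : ℝ) < n := by exact_mod_cast hn
  rw [key, ← ofReal_norm, hv, ENNReal.ofReal_one, one_mul, ← mul_assoc,
    ← ENNReal.ofReal_natCast, ← ENNReal.ofReal_mul hn0.le, mul_div_cancel₀ _ hn0.ne']

end FlatCone

/-! ### The gauge and the radial projection onto the boundary -/

section Gauge

variable {n : ℕ}

local notation "𝔼" => EuclideanSpace ℝ (Fin n)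

variable {K : ConvexBody (EuclideanSpace ℝ (Fin n))}

theorem mem_nhds_zero (hK : (0 : 𝔼) ∈ interior (K : Set 𝔼)) : (K : Set 𝔼) ∈ nhds 0 :=
  mem_interior_iff_mem_nhds.1 hK

theorem gauge_le_one_iff (hK : (0 : 𝔼) ∈ interior (K : Set 𝔼)) {x : 𝔼} :
    gauge (K : Set 𝔼) x ≤ 1 ↔ x ∈ (K : Set 𝔼) := by
  rw [gauge_le_one_iff_mem_closure K.convex (mem_nhds_zero hK), K.isClosed.closure_eq]

theorem gauge_eq_one_iff (hK : (0 : 𝔼) ∈ interior (K : Set 𝔼)) {x : 𝔼} :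
    gauge (K : Set 𝔼) x = 1 ↔ x ∈ frontier (K : Set 𝔼) :=
  gauge_eq_one_iff_mem_frontier K.convex (mem_nhds_zero hK)

theorem exists_norm_le_mul_gauge (hK : (0 : 𝔼) ∈ interior (K : Set 𝔼)) :
    ∃ R : ℝ, 0 < R ∧ ∀ x : 𝔼, ‖x‖ ≤ R * gauge (K : Set 𝔼) x := by
  obtain ⟨R, hR, hKR⟩ := K.isBounded.subset_closedBall_lt 0 0
  refine ⟨R, hR, fun x => ?_⟩
  have := le_gauge_of_subset_closedBall (x := x) (absorbent_nhds_zero (mem_nhds_zero hK)) hR.le hKR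
  rwa [div_le_iff₀' hR] at this

theorem gauge_pos_of_ne_zero (hK : (0 : 𝔼) ∈ interior (K : Set 𝔼)) {x : 𝔼} (hx : x ≠ 0) :
    0 < gauge (K : Set 𝔼) x := by
  obtain ⟨R, hR, h⟩ := exists_norm_le_mul_gauge hK
  exact pos_of_mul_pos_right ((norm_pos_iff.2 hx).trans_le (h x)) hR.le

theorem continuous_gauge_body (hK : (0 : 𝔼) ∈ interior (K : Set 𝔼)) :
    Continuous (gauge (K : Set 𝔼)) :=
  continuous_gauge K.convex (mem_nhds_zero hK)

/-- The radial projection onto the boundary of a convex body, with `0 ↦ 0`. -/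
noncomputable def radialProj (K : ConvexBody 𝔼) (x : 𝔼) : 𝔼 := (gauge (K : Set 𝔼) x)⁻¹ • x

theorem measurable_radialProj (hK : (0 : 𝔼) ∈ interior (K : Set 𝔼)) :
    Measurable (radialProj K) :=
  (continuous_gauge_body hK).measurable.inv.smul measurable_id

theorem gauge_radialProj (hK : (0 : 𝔼) ∈ interior (K : Set 𝔼)) {x : 𝔼} (hx : x ≠ 0) :
    gauge (K : Set 𝔼) (radialProj K x) = 1 := by
  rw [radialProj, gauge_smul_of_nonneg (inv_nonneg.2 (gauge_nonneg x)), smul_eq_mul,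
    inv_mul_cancel₀ (gauge_pos_of_ne_zero hK hx).ne']

theorem gauge_smul_radialProj (hK : (0 : 𝔼) ∈ interior (K : Set 𝔼)) (x : 𝔼) :
    gauge (K : Set 𝔼) x • radialProj K x = x := by
  rcases eq_or_ne x 0 with rfl | hx
  · simp [radialProj]
  · rw [radialProj, smul_smul, mul_inv_cancel₀ (gauge_pos_of_ne_zero hK hx).ne', one_smul]

theorem radialProj_smul {r : ℝ} (hr : 0 < r) (x : 𝔼) :
    radialProj K (r • x) = radialProj K x := by
  rw [radialProj, radialProj, gauge_smul_of_nonneg hr.le, smul_smul, smul_eq_mul]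
  congr 1
  field_simp

theorem radialProj_of_mem_frontier (hK : (0 : 𝔼) ∈ interior (K : Set 𝔼)) {z : 𝔼}
    (hz : z ∈ frontier (K : Set 𝔼)) : radialProj K z = z := by
  rw [radialProj, (gauge_eq_one_iff hK).2 hz, inv_one, one_smul]

theorem ne_zero_of_radialProj_mem (hK : (0 : 𝔼) ∈ interior (K : Set 𝔼)) {x : 𝔼}
    (hx : radialProj K x ∈ frontier (K : Set 𝔼)) : x ≠ 0 := by
  rintro rfl
  rw [← gauge_eq_one_iff hK] at hx
  simp [radialProj] at hx

theorem radialProj_mem_frontier (hK : (0 : 𝔼) ∈ interior (K : Set 𝔼)) {x : 𝔼} (hx : x ≠ 0) :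
    radialProj K x ∈ frontier (K : Set 𝔼) :=
  (gauge_eq_one_iff hK).1 (gauge_radialProj hK hx)

end Gauge

/-! ### Comparison of cone volume and Hausdorff measure on nearly flat pieces -/

section LocalEstimate

variable {n : ℕ}

local notation "𝔼" => EuclideanSpace ℝ (Fin n)

variable {K : ConvexBody (EuclideanSpace ℝ (Fin n))}

theorem euclideanHausdorffMeasure_image_le {X Y : Type*} [EMetricSpace X] [MeasurableSpace X]
    [BorelSpace X] [EMetricSpace Y] [MeasurableSpace Y] [BorelSpace Y] {f : X → Y} {C : NNReal}
    {s : Set X} (hf : LipschitzOnWith C f s) (d : ℕ) :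
    μHE[d] (f '' s) ≤ (C : ENNReal) ^ d * μHE[d] s := by
  rw [Measure.euclideanHausdorffMeasure_def, Measure.euclideanHausdorffMeasure_def,
    Measure.smul_apply, Measure.smul_apply, ENNReal.smul_def, ENNReal.smul_def, smul_eq_mul,
    smul_eq_mul, mul_left_comm]
  gcongr
  simpa using hf.hausdorffMeasure_image_le (d := d) (by positivity)

/-- The map flattening the cone over a piece of the boundary near a point with normal `v` onto a
cone over a piece of the hyperplane `⟪v, ·⟫ = c`. -/
noncomputable def flatten (K : ConvexBody 𝔼) (v : 𝔼) (c : ℝ) (x : 𝔼) : 𝔼 :=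
  x - (⟪v, x⟫ - c * gauge (K : Set 𝔼) x) • v

theorem continuous_flatten (hK : (0 : 𝔼) ∈ interior (K : Set 𝔼)) (v : 𝔼) (c : ℝ) :
    Continuous (flatten K v c) := by
  have := continuous_gauge_body hK
  unfold flatten
  fun_prop

/-- `flatten` is positively homogeneous and moves each boundary point along v to height c, so it
carries cones over boundary pieces to flat cones. -/
theorem flatten_smul (v : 𝔼) (c : ℝ) {r : ℝ} (hr : 0 ≤ r) {z : 𝔼}
    (hz : gauge (K : Set 𝔼) z = 1) :
    flatten K v c (r • z) = r • ((z - ⟪v, z⟫ • v) + c • v) := by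
  rw [flatten, gauge_smul_of_nonneg hr, hz, inner_smul_right]
  simp only [smul_eq_mul]
  module

theorem image_flatten (hK : (0 : 𝔼) ∈ interior (K : Set 𝔼)) (v : 𝔼) (c : ℝ) {A : Set 𝔼}
    (hA : A ⊆ frontier (K : Set 𝔼)) :
    flatten K v c '' ((K : Set 𝔼) ∩ radialProj K ⁻¹' A) =
      {x | ∃ r ∈ Ioc (0 : ℝ) 1, ∃ b ∈ (fun z => z - ⟪v, z⟫ • v) '' A, x = r • (b + c • v)} := by
  ext y
  constructor
  · rintro ⟨x, ⟨hxK, hxA⟩, rfl⟩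
    have hx0 := ne_zero_of_radialProj_mem hK (hA hxA)
    refine ⟨gauge (K : Set 𝔼) x, ⟨gauge_pos_of_ne_zero hK hx0, (gauge_le_one_iff hK).2 hxK⟩, _,
      ⟨_, hxA, rfl⟩, ?_⟩
    rw [← flatten_smul v c (gauge_nonneg x) (gauge_radialProj hK hx0), gauge_smul_radialProj hK]
  · rintro ⟨r, hr, _, ⟨z, hz, rfl⟩, rfl⟩
    have hz1 := (gauge_eq_one_iff hK).2 (hA hz)
    refine ⟨r • z, ⟨?_, ?_⟩, flatten_smul v c hr.1.le hz1⟩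
    · rw [← gauge_le_one_iff hK, gauge_smul_of_nonneg hr.1.le, hz1, smul_eq_mul, mul_one]
      exact hr.2
    · rw [mem_preimage, radialProj_smul hr.1, radialProj_of_mem_frontier hK (hA hz)]
      exact hz

/-- This bounds the Lipschitz constant of `flatten` minus the identity. The difference splits as
r⟨v, z - z'⟩ + (r - r')(⟨v, z'⟩ - c). Lipschitz continuity of the gauge controls |r - r'|, and with
the boundedness of K also r‖z - z'‖. -/
theorem abs_height_sub_le {L R : ℝ}
    (hL : ∀ x y : 𝔼, |gauge (K : Set 𝔼) x - gauge (K : Set 𝔼) y| ≤ L * ‖x - y‖)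
    (hR : ∀ x : 𝔼, ‖x‖ ≤ R * gauge (K : Set 𝔼) x) (v : 𝔼) (c : ℝ) {ε : ℝ} (hε : 0 ≤ ε)
    {r r' : ℝ} (hr : 0 ≤ r) (hr' : 0 ≤ r') {z z' : 𝔼} (hz : gauge (K : Set 𝔼) z = 1)
    (hz' : gauge (K : Set 𝔼) z' = 1) (h1 : |⟪v, z - z'⟫| ≤ ε * ‖z - z'‖)
    (h2 : |⟪v, z'⟫ - c| ≤ ε) :
    |(⟪v, r • z⟫ - c * r) - (⟪v, r' • z'⟫ - c * r')| ≤
      ε * (1 + L * R + L) * ‖r • z - r' • z'‖ := by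
  have hrr : |r - r'| ≤ L * ‖r • z - r' • z'‖ := by
    have := hL (r • z) (r' • z')
    rwa [gauge_smul_of_nonneg hr, gauge_smul_of_nonneg hr', hz, hz', smul_eq_mul, smul_eq_mul,
      mul_one, mul_one] at this
  have hz'R : ‖z'‖ ≤ R := by simpa [hz'] using hR z'
  have hrz : r * ‖z - z'‖ ≤ (1 + L * R) * ‖r • z - r' • z'‖ := by
    have e : r • (z - z') = (r • z - r' • z') - (r - r') • z' := by module
    calc r * ‖z - z'‖ = ‖r • (z - z')‖ := by rw [norm_smul, Real.norm_of_nonneg hr]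
      _ ≤ ‖r • z - r' • z'‖ + ‖(r - r') • z'‖ := by rw [e]; exact norm_sub_le _ _
      _ ≤ ‖r • z - r' • z'‖ + L * ‖r • z - r' • z'‖ * R := by
        rw [norm_smul, Real.norm_eq_abs]
        gcongr
        exact (abs_nonneg _).trans hrr
      _ = _ := by ring
  have e : (⟪v, r • z⟫ - c * r) - (⟪v, r' • z'⟫ - c * r') =
      r * ⟪v, z - z'⟫ + (r - r') * (⟪v, z'⟫ - c) := by
    simp only [inner_smul_right, inner_sub_right]
    ring
  rw [e]
  calc |r * ⟪v, z - z'⟫ + (r - r') * (⟪v, z'⟫ - c)|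
      ≤ r * |⟪v, z - z'⟫| + |r - r'| * |⟪v, z'⟫ - c| := by
        refine (abs_add_le _ _).trans_eq ?_
        rw [abs_mul, abs_mul, abs_of_nonneg hr]
    _ ≤ r * (ε * ‖z - z'‖) + (L * ‖r • z - r' • z'‖) * ε := by
        have := (abs_nonneg _).trans hrr
        gcongr
    _ = ε * (r * ‖z - z'‖) + ε * L * ‖r • z - r' • z'‖ := by ring
    _ ≤ ε * ((1 + L * R) * ‖r • z - r' • z'‖) + ε * L * ‖r • z - r' • z'‖ := by gcongr
    _ = _ := by ring

theorem norm_sub_proj_le {v : 𝔼} (hv : ‖v‖ = 1) (x : 𝔼) : ‖x - ⟪v, x⟫ • v‖ ≤ ‖x‖ := by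
  have h : ‖x - ⟪v, x⟫ • v‖ ^ 2 ≤ ‖x‖ ^ 2 := by
    rw [norm_sub_sq_real, norm_smul, hv, inner_smul_right, real_inner_comm, mul_one,
      Real.norm_eq_abs, sq_abs, real_inner_comm]
    nlinarith [sq_nonneg ⟪v, x⟫, real_inner_comm v x]
  exact (pow_le_pow_iff_left₀ (norm_nonneg _) (norm_nonneg _) two_ne_zero).1 h

theorem norm_le_of_abs_inner_le {v : 𝔼} (hv : ‖v‖ = 1) {x : 𝔼} {ε : ℝ} (hε : ε < 1)
    (h : |⟪v, x⟫| ≤ ε * ‖x‖) : ‖x‖ ≤ (1 - ε)⁻¹ * ‖x - ⟪v, x⟫ • v‖ := by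
  rw [← div_eq_inv_mul, le_div_iff₀ (by linarith)]
  have h1 : ‖x‖ ≤ ‖x - ⟪v, x⟫ • v‖ + ‖⟪v, x⟫ • v‖ := by
    simpa using norm_add_le (x - ⟪v, x⟫ • v) (⟪v, x⟫ • v)
  rw [norm_smul, hv, mul_one, Real.norm_eq_abs] at h1
  linarith

theorem hausdorff_proj_le (d : ℕ) {v : 𝔼} (hv : ‖v‖ = 1) (A : Set 𝔼) :
    μHE[d] ((fun z : 𝔼 => z - ⟪v, z⟫ • v) '' A) ≤ μHE[d] A := by
  have hl : LipschitzOnWith 1 (fun z : 𝔼 => z - ⟪v, z⟫ • v) A := by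
    refine LipschitzOnWith.of_dist_le_mul fun x _ y _ => ?_
    rw [dist_eq_norm, dist_eq_norm, NNReal.coe_one, one_mul]
    refine le_trans (le_of_eq ?_) (norm_sub_proj_le hv (x - y))
    rw [inner_sub_right]
    congr 1
    module
  simpa using euclideanHausdorffMeasure_image_le hl d

/-- On a set whose chords are nearly orthogonal to v, the projection along v is injective and its
inverse is Lipschitz with constant 1/(1 - ε). -/
theorem hausdorff_le_proj (d : ℕ) {v : 𝔼} (hv : ‖v‖ = 1) {A : Set 𝔼} {ε : NNReal} (hε : ε < 1)
    (hA : ∀ z ∈ A, ∀ z' ∈ A, |⟪v, z - z'⟫| ≤ ε * ‖z - z'‖) :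
    μHE[d] A ≤ ((1 - ε)⁻¹ : NNReal) ^ d *
      μHE[d] ((fun z : 𝔼 => z - ⟪v, z⟫ • v) '' A) := by
  set p : 𝔼 → 𝔼 := fun z => z - ⟪v, z⟫ • v with hp
  have key : ∀ z ∈ A, ∀ z' ∈ A, ‖z - z'‖ ≤ (1 - (ε : ℝ))⁻¹ * ‖p z - p z'‖ := by
    intro z hz z' hz'
    refine (norm_le_of_abs_inner_le hv (by exact_mod_cast hε) (hA z hz z' hz')).trans_eq ?_
    rw [inner_sub_right, hp]
    congr 2
    module
  have hinj : InjOn p A := by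
    intro z hz z' hz' h
    have := key z hz z' hz'
    rw [h, sub_self, norm_zero, mul_zero] at this
    exact sub_eq_zero.1 (norm_le_zero_iff.1 this)
  have hl : LipschitzOnWith (1 - ε)⁻¹ (Function.invFunOn p A) (p '' A) := by
    refine LipschitzOnWith.of_dist_le_mul ?_
    rintro _ ⟨z, hz, rfl⟩ _ ⟨z', hz', rfl⟩
    rw [hinj.leftInvOn_invFunOn hz, hinj.leftInvOn_invFunOn hz', dist_eq_norm, dist_eq_norm,
      NNReal.coe_inv, NNReal.coe_sub hε.le, NNReal.coe_one]
    exact key z hz z' hz'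
  have := euclideanHausdorffMeasure_image_le hl d
  rwa [hinj.leftInvOn_invFunOn.image_image] at this

/-- On pieces of the boundary that are nearly orthogonal to `v` and at height nearly `c`, the
cone measure is nearly `c` times the Hausdorff measure. -/
theorem exists_local_estimate (hn : 1 ≤ n) (hK : (0 : 𝔼) ∈ interior (K : Set 𝔼)) {t : NNReal}
    (ht : 1 < t) : ∃ ε : ℝ, 0 < ε ∧ ∀ (v : 𝔼) (c : ℝ) (A : Set 𝔼), ‖v‖ = 1 → 0 < c →
      A ⊆ frontier (K : Set 𝔼) → MeasurableSet A →
      (∀ z ∈ A, ∀ z' ∈ A, |⟪v, z - z'⟫| ≤ ε * ‖z - z'‖) → (∀ z ∈ A, |⟪v, z⟫ - c| ≤ ε) →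
      ENNReal.ofReal c * μHE[n - 1] A ≤
        t * (n * volume ((K : Set 𝔼) ∩ radialProj K ⁻¹' A)) ∧
      n * volume ((K : Set 𝔼) ∩ radialProj K ⁻¹' A) ≤ t * (ENNReal.ofReal c * μHE[n - 1] A) := by
  obtain ⟨R, hR0, hR⟩ := exists_norm_le_mul_gauge hK
  obtain ⟨L, hL⟩ := K.convex.lipschitz_gauge (mem_nhds_zero hK)
  -- One factor s pays for the distortion of volume by `flatten`, the other for the distortion of
  -- H^{n-1} by the projection.
  obtain ⟨s, hs1, hst⟩ : ∃ s : NNReal, 1 < s ∧ s * s ≤ t := by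
    refine ⟨NNReal.sqrt t, ?_, (NNReal.mul_self_sqrt t).le⟩
    by_contra! h
    exact ht.not_ge ((NNReal.mul_self_sqrt t).symm.le.trans (mul_le_one₀ h zero_le h))
  have hdet : ENNReal.ofReal |(ContinuousLinearMap.id ℝ 𝔼).det| = 1 := by
    simp [ContinuousLinearMap.det]
  have ev1 := addHaar_image_le_mul_of_det_lt (volume : Measure 𝔼) (ContinuousLinearMap.id ℝ 𝔼)
    (m := s) (by rw [hdet]; exact_mod_cast hs1)
  have ev2 := mul_le_addHaar_image_of_lt_det (volume : Measure 𝔼) (ContinuousLinearMap.id ℝ 𝔼)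
    (m := s⁻¹) (by rw [hdet]; exact_mod_cast inv_lt_one_of_one_lt₀ hs1)
  have ev3 : ∀ᶠ δ in nhdsWithin (0 : NNReal) (Ioi 0), ((1 - δ)⁻¹) ^ (n - 1) < s := by
    have h1 : Filter.Tendsto (fun δ : NNReal => ((1 - δ)⁻¹) ^ (n - 1)) (nhds 0)
        (nhds (((1 - 0)⁻¹) ^ (n - 1))) := by
      refine Filter.Tendsto.pow (Filter.Tendsto.inv₀ ?_ (by simp)) _
      exact (continuous_const.sub continuous_id).tendsto 0
    rw [tsub_zero, inv_one, one_pow] at h1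
    exact nhdsWithin_le_nhds (h1.eventually_lt_const hs1)
  have ev4 : ∀ᶠ δ in nhdsWithin (0 : NNReal) (Ioi 0), δ < 1 :=
    nhdsWithin_le_nhds (eventually_lt_nhds one_pos)
  obtain ⟨δ, ⟨⟨⟨h1, h2⟩, h3⟩, h4⟩, hδ⟩ :=
    ((((ev1.and ev2).and ev3).and ev4).and self_mem_nhdsWithin).exists
  have hδ0 : (0 : ℝ) < δ := hδ
  have hC : 1 ≤ 1 + L * R + L := by
    have : 0 ≤ L * R := mul_nonneg L.2 hR0.le
    have : (0 : ℝ) ≤ L := L.2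
    linarith
  have hεδ : (δ : ℝ) / (1 + L * R + L) ≤ δ := div_le_self hδ0.le hC
  have hε0 : 0 ≤ (δ : ℝ) / (1 + L * R + L) := div_nonneg hδ0.le (by linarith)
  -- With this ε, the constant of `abs_height_sub_le` is exactly δ; since ε ≤ δ, δ also serves in
  -- `hausdorff_le_proj`.
  refine ⟨δ / (1 + L * R + L), div_pos hδ0 (by linarith), ?_⟩
  intro v c A hv hc hA hAm hA1 hA2
  have hL' : ∀ x y : 𝔼, |gauge (K : Set 𝔼) x - gauge (K : Set 𝔼) y| ≤ L * ‖x - y‖ := by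
    intro x y
    simpa [dist_eq_norm] using hL.dist_le_mul x y
  have happ : ApproximatesLinearOn (flatten K v c) (ContinuousLinearMap.id ℝ 𝔼)
      ((K : Set 𝔼) ∩ radialProj K ⁻¹' A) δ := by
    intro x hx y hy
    have hx0 := ne_zero_of_radialProj_mem hK (hA hx.2)
    have hy0 := ne_zero_of_radialProj_mem hK (hA hy.2)
    have key := abs_height_sub_le hL' hR v c hε0
      (gauge_nonneg (s := (K : Set 𝔼)) x) (gauge_nonneg (s := (K : Set 𝔼)) y)
      (gauge_radialProj hK hx0) (gauge_radialProj hK hy0)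
      (hA1 _ hx.2 _ hy.2) (hA2 _ hy.2)
    rw [gauge_smul_radialProj hK, gauge_smul_radialProj hK,
      div_mul_cancel₀ _ (by linarith : (1 + L * R + L : ℝ) ≠ 0)] at key
    refine le_trans (le_of_eq ?_) key
    have e : flatten K v c x - flatten K v c y - (x - y) =
        (-((⟪v, x⟫ - c * gauge (K : Set 𝔼) x) - (⟪v, y⟫ - c * gauge (K : Set 𝔼) y))) • v := by
      rw [flatten, flatten]
      module
    rw [ContinuousLinearMap.id_apply, e, norm_smul, hv, mul_one, norm_neg, Real.norm_eq_abs]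
  have hm : MeasurableSet ((K : Set 𝔼) ∩ radialProj K ⁻¹' A) :=
    K.isClosed.measurableSet.inter (measurable_radialProj hK hAm)
  -- Injectivity makes the image Borel, as slicing requires.
  have hinj : InjOn (flatten K v c) ((K : Set 𝔼) ∩ radialProj K ⁻¹' A) := by
    intro x hx y hy hxy
    have := happ x hx y hy
    rw [hxy, sub_self, zero_sub, norm_neg, ContinuousLinearMap.id_apply] at this
    have h4' : (δ : ℝ) < 1 := by exact_mod_cast h4
    have h0 : ‖x - y‖ ≤ 0 := by nlinarith [norm_nonneg (x - y)]
    exact sub_eq_zero.1 (norm_le_zero_iff.1 h0)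
  have hFm := hm.image_of_continuousOn_injOn (continuous_flatten hK v c).continuousOn hinj
  have hflat : (n : ENNReal) * volume (flatten K v c '' ((K : Set 𝔼) ∩ radialProj K ⁻¹' A)) =
      ENNReal.ofReal c * μHE[n - 1] ((fun z => z - ⟪v, z⟫ • v) '' A) := by
    rw [image_flatten hK v c hA] at hFm ⊢
    refine volume_flatCone hn hv hc ?_ hFm
    rintro _ ⟨z, -, rfl⟩
    simp [inner_sub_right, inner_smul_right, hv]
  have hs0 : (s : ENNReal) ≠ 0 := by exact_mod_cast (one_pos.trans hs1).ne'
  have b1 := h1 _ _ happ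
  have b2 : volume ((K : Set 𝔼) ∩ radialProj K ⁻¹' A) ≤
      s * volume (flatten K v c '' ((K : Set 𝔼) ∩ radialProj K ⁻¹' A)) := by
    have := h2 _ _ happ
    rw [ENNReal.coe_inv (one_pos.trans hs1).ne'] at this
    calc volume ((K : Set 𝔼) ∩ radialProj K ⁻¹' A)
        = s * ((s : ENNReal)⁻¹ * volume ((K : Set 𝔼) ∩ radialProj K ⁻¹' A)) := by
          rw [← mul_assoc, ENNReal.mul_inv_cancel hs0 ENNReal.coe_ne_top, one_mul]
      _ ≤ _ := by gcongr
  have b3 : μHE[n - 1] A ≤ s * μHE[n - 1] ((fun z => z - ⟪v, z⟫ • v) '' A) := by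
    refine (hausdorff_le_proj (n - 1) hv h4 fun z hz z' hz' =>
      (hA1 z hz z' hz').trans (by gcongr)).trans ?_
    gcongr
    exact_mod_cast h3.le
  have b4 := hausdorff_proj_le (n - 1) hv A
  have hst' : (s : ENNReal) * s ≤ t := by exact_mod_cast hst
  have hst'' : (s : ENNReal) ≤ t :=
    le_trans (by exact_mod_cast le_mul_of_one_le_right s.2 hs1.le) hst'
  constructor
  · calc ENNReal.ofReal c * μHE[n - 1] A
        ≤ ENNReal.ofReal c * (s * μHE[n - 1] ((fun z => z - ⟪v, z⟫ • v) '' A)) := by gcongr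
      _ = s * (n * volume (flatten K v c '' ((K : Set 𝔼) ∩ radialProj K ⁻¹' A))) := by
        rw [hflat, mul_left_comm]
      _ ≤ s * (n * (s * volume ((K : Set 𝔼) ∩ radialProj K ⁻¹' A))) := by gcongr
      _ = s * s * (n * volume ((K : Set 𝔼) ∩ radialProj K ⁻¹' A)) := by ring
      _ ≤ _ := by gcongr
  · calc (n : ENNReal) * volume ((K : Set 𝔼) ∩ radialProj K ⁻¹' A)
        ≤ n * (s * volume (flatten K v c '' ((K : Set 𝔼) ∩ radialProj K ⁻¹' A))) := by gcongr
      _ = s * (ENNReal.ofReal c * μHE[n - 1] ((fun z => z - ⟪v, z⟫ • v) '' A)) := by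
        rw [← hflat, mul_left_comm]
      _ ≤ _ := by gcongr

end LocalEstimate

/-! ### Outer normals: continuity and measurability of the Gauss map -/

section GaussMap

variable {n : ℕ}

local notation "𝔼" => EuclideanSpace ℝ (Fin n)

variable {K : ConvexBody (EuclideanSpace ℝ (Fin n))}

theorem isOuterUnitNormal_gaussMap {z : 𝔼} (hz : z ∈ regularBoundary K) :
    IsOuterUnitNormal K z (gaussMap K z) := by
  have h : ∃ v, IsOuterUnitNormal K z v := hz.2.exists
  rw [gaussMap, dif_pos h]
  exact h.choose_spec

theorem gaussMap_eq {z v : 𝔼} (hz : z ∈ regularBoundary K) (hv : IsOuterUnitNormal K z v) :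
    gaussMap K z = v :=
  hz.2.unique (isOuterUnitNormal_gaussMap hz) hv

theorem mem_of_mem_frontier {z : 𝔼} (hz : z ∈ frontier (K : Set 𝔼)) : z ∈ K :=
  K.isClosed.frontier_subset hz

theorem bodySupport_eq {z v : 𝔼} (hz : z ∈ K) (hv : IsOuterUnitNormal K z v) :
    bodySupport K v = ⟪z, v⟫ := by
  refine IsGreatest.csSup_eq ⟨⟨z, hz, rfl⟩, ?_⟩
  rintro _ ⟨y, hy, rfl⟩
  exact hv.2 y hy

theorem continuous_bodySupport : Continuous (bodySupport K) :=
  IsCompact.continuous_sSup (f := fun v z : 𝔼 => ⟪z, v⟫) K.isCompact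
    (continuous_snd.inner continuous_fst)

theorem bodySupport_gaussMap {z : 𝔼} (hz : z ∈ regularBoundary K) :
    bodySupport K (gaussMap K z) = ⟪z, gaussMap K z⟫ :=
  bodySupport_eq (mem_of_mem_frontier hz.1) (isOuterUnitNormal_gaussMap hz)

/-- If K contains the ball of radius ρ about 0, then ρv lies in K for every unit vector v. This
uniform bound keeps h⁻¹ bounded. -/
theorem exists_le_inner_normal (hK : (0 : 𝔼) ∈ interior (K : Set 𝔼)) :
    ∃ ρ : ℝ, 0 < ρ ∧ ∀ z v, IsOuterUnitNormal K z v → ρ ≤ ⟪z, v⟫ := by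
  obtain ⟨ρ, hρ, h⟩ := Metric.nhds_basis_closedBall.mem_iff.1 (mem_nhds_zero hK)
  refine ⟨ρ, hρ, fun z v hv => ?_⟩
  have := hv.2 (ρ • v) (h (by simp [norm_smul, hv.1, abs_of_pos hρ]))
  simpa [inner_smul_left, hv.1] using this

theorem isClosed_isOuterUnitNormal :
    IsClosed {p : 𝔼 × 𝔼 | IsOuterUnitNormal K p.1 p.2} := by
  simp only [IsOuterUnitNormal, ofPred_and, ofPred_forall]
  refine (isClosed_eq (by fun_prop) (by fun_prop)).inter ?_
  exact isClosed_iInter fun y => isClosed_iInter fun _ => isClosed_le (by fun_prop) (by fun_prop)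

theorem isCompact_normalPairs :
    IsCompact {p : 𝔼 × 𝔼 | p.1 ∈ frontier (K : Set 𝔼) ∧ IsOuterUnitNormal K p.1 p.2} := by
  have hc : IsCompact (frontier (K : Set 𝔼) ×ˢ Metric.sphere (0 : 𝔼) 1) :=
    (K.isCompact.of_isClosed_subset isClosed_frontier K.isClosed.frontier_subset).prod
      (isCompact_sphere _ _)
  refine hc.of_isClosed_subset ?_ fun p hp => ⟨hp.1, by simpa using hp.2.1⟩
  exact (isClosed_frontier.preimage continuous_fst).inter isClosed_isOuterUnitNormal

/-- A closed graph argument: the preimage of a closed set is the trace of a projection of a compact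
set of normal pairs, by uniqueness of the normal at regular points. -/
theorem continuousOn_gaussMap : ContinuousOn (gaussMap K) (regularBoundary K) := by
  rw [continuousOn_iff_isClosed]
  intro t ht
  refine ⟨Prod.fst '' ({p : 𝔼 × 𝔼 | p.1 ∈ frontier (K : Set 𝔼) ∧ IsOuterUnitNormal K p.1 p.2} ∩
    Prod.snd ⁻¹' t), ((isCompact_normalPairs.inter_right
      (ht.preimage continuous_snd)).image continuous_fst).isClosed, ?_⟩
  ext z
  constructor
  · rintro ⟨hz, hzr⟩
    exact ⟨⟨(z, gaussMap K z), ⟨⟨hzr.1, isOuterUnitNormal_gaussMap hzr⟩, hz⟩, rfl⟩, hzr⟩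
  · rintro ⟨⟨⟨z', v⟩, ⟨⟨h1, h2⟩, h3⟩, rfl⟩, hzr⟩
    refine ⟨?_, hzr⟩
    rw [mem_preimage, gaussMap_eq hzr h2]
    exact h3

/-- The irregular points are those with two normals at distance at least 1/(k+1) for some k. For
each k they form the projection of a compact set. -/
theorem measurableSet_regularBoundary : MeasurableSet (regularBoundary K) := by
  set G := {p : 𝔼 × 𝔼 | p.1 ∈ frontier (K : Set 𝔼) ∧ IsOuterUnitNormal K p.1 p.2} with hG
  have hGc : IsCompact G := isCompact_normalPairs
  let D : ℕ → Set ((𝔼 × 𝔼) × (𝔼 × 𝔼)) := fun k =>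
    (G ×ˢ G) ∩ {q | q.1.1 = q.2.1 ∧ 1 / ((k : ℝ) + 1) ≤ ‖q.1.2 - q.2.2‖}
  have hD : ∀ k, IsCompact (D k) := fun k => (hGc.prod hGc).inter_right
    ((isClosed_eq (f := fun q : (𝔼 × 𝔼) × (𝔼 × 𝔼) => q.1.1) (g := fun q => q.2.1)
      (by fun_prop) (by fun_prop)).inter (isClosed_le (g := fun q : (𝔼 × 𝔼) × (𝔼 × 𝔼) =>
        ‖q.1.2 - q.2.2‖) continuous_const (by fun_prop)))
  have hS : regularBoundary K =
      Prod.fst '' G \ ⋃ k, (fun q : (𝔼 × 𝔼) × (𝔼 × 𝔼) => q.1.1) '' D k := by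
    ext z
    constructor
    · intro hz
      refine ⟨⟨(z, gaussMap K z), ⟨hz.1, isOuterUnitNormal_gaussMap hz⟩, rfl⟩, ?_⟩
      rw [mem_iUnion]
      rintro ⟨k, ⟨⟨z₁, v⟩, ⟨z₂, w⟩⟩, ⟨⟨h1, h2⟩, h3, h4⟩, rfl⟩
      simp only at h3 h4
      subst h3
      have hvw : v = w := hz.2.unique h1.2 h2.2
      rw [hvw, sub_self, norm_zero] at h4
      exact absurd h4 (not_le.2 (by positivity))
    · rintro ⟨⟨⟨z', v⟩, hv, rfl⟩, h⟩
      refine ⟨hv.1, v, hv.2, fun w hw => ?_⟩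
      by_contra hne
      obtain ⟨k, hk⟩ := exists_nat_one_div_lt (norm_pos_iff.2 (sub_ne_zero.2 hne))
      exact h (mem_iUnion.2 ⟨k, ((z', w), (z', v)), ⟨⟨⟨hv.1, hw⟩, hv⟩, rfl, hk.le⟩, rfl⟩)
  rw [hS]
  exact (hGc.image continuous_fst).measurableSet.diff
    (MeasurableSet.iUnion fun k => ((hD k).image (by fun_prop)).measurableSet)

end GaussMap

/-! ### The cone measure has density h(ν) on the regular boundary -/

section ConeMeasure

variable {n : ℕ}

local notation "𝔼" => EuclideanSpace ℝ (Fin n)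

variable {K : ConvexBody (EuclideanSpace ℝ (Fin n))}

/-- A local comparison of two measures on a set extends to the whole set. -/
theorem measure_le_mul_of_locally {X : Type*} [TopologicalSpace X] [SecondCountableTopology X]
    [MeasurableSpace X] [OpensMeasurableSpace X] {μ ν : Measure X} {S : Set X} {C : ENNReal}
    (h : ∀ x ∈ S, ∃ U : Set X, IsOpen U ∧ x ∈ U ∧
      ∀ A, MeasurableSet A → A ⊆ U ∩ S → μ A ≤ C * ν A)
    {A : Set X} (hA : MeasurableSet A) (hAS : A ⊆ S) : μ A ≤ C * ν A := by
  rcases A.eq_empty_or_nonempty with rfl | ⟨x₀, hx₀⟩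
  · simp
  choose! U hUo hxU hU using h
  -- By the Lindelöf property countably many of the sets U cover S; made disjoint, they cut A into
  -- pieces whose measures add up.
  obtain ⟨T, hTS, hTc, hT⟩ := TopologicalSpace.countable_cover_nhdsWithin
    (s := S) (f := U) fun x hx => mem_nhdsWithin_of_mem_nhds ((hUo x hx).mem_nhds (hxU x hx))
  have hTne : T.Nonempty := by
    obtain ⟨i, hi, -⟩ := mem_iUnion₂.1 (hT (hAS hx₀))
    exact ⟨i, hi⟩
  obtain ⟨g, rfl⟩ := hTc.exists_eq_range hTne
  have hgS : ∀ k, g k ∈ S := fun k => hTS (mem_range_self k)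
  have hm : ∀ k, MeasurableSet (A ∩ disjointed (fun k => U (g k)) k) := fun k =>
    hA.inter (MeasurableSet.disjointed (fun k => (hUo _ (hgS k)).measurableSet) k)
  have hd : Pairwise (Function.onFun Disjoint fun k => A ∩ disjointed (fun k => U (g k)) k) :=
    fun i j hij => ((disjoint_disjointed _ hij).mono inter_subset_right inter_subset_right)
  have hAU : A = ⋃ k, A ∩ disjointed (fun k => U (g k)) k := by
    rw [← inter_iUnion, iUnion_disjointed, eq_comm, inter_eq_left]
    exact hAS.trans (by simpa using hT)
  rw [hAU, measure_iUnion hd hm, measure_iUnion hd hm, ← ENNReal.tsum_mul_left]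
  exact ENNReal.tsum_le_tsum fun k => hU (g k) (hgS k) _ (hm k) fun x hx =>
    ⟨disjointed_subset (fun k => U (g k)) k hx.2, hAS hx.1⟩

theorem le_of_forall_one_lt_le_sq_mul {a b : ENNReal}
    (h : ∀ t : NNReal, 1 < t → a ≤ t * t * b) : a ≤ b := by
  have h1 : Filter.Tendsto (fun t : NNReal => ((t * t : NNReal) : ENNReal) * b)
      (nhdsWithin 1 (Ioi 1)) (nhds (((1 * 1 : NNReal) : ENNReal) * b)) := by
    refine ENNReal.Tendsto.mul_const ?_ (Or.inl (by simp))
    refine (ENNReal.continuous_coe.tendsto _).comp (Filter.Tendsto.mono_left ?_ nhdsWithin_le_nhds)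
    exact (continuous_id.mul continuous_id).tendsto 1
  rw [mul_one, ENNReal.coe_one, one_mul] at h1
  refine ge_of_tendsto h1 ?_
  filter_upwards [self_mem_nhdsWithin] with t ht
  simpa using h t ht

/-- The cone measure of a convex body, `A ↦ n V(K ∩ cone A)`. -/
noncomputable def coneMeasure (K : ConvexBody 𝔼) : Measure 𝔼 :=
  (n : ENNReal) • (volume.restrict (K : Set 𝔼)).map (radialProj K)

theorem coneMeasure_apply (hK : (0 : 𝔼) ∈ interior (K : Set 𝔼)) {A : Set 𝔼}
    (hA : MeasurableSet A) :
    coneMeasure K A = n * volume ((K : Set 𝔼) ∩ radialProj K ⁻¹' A) := by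
  rw [coneMeasure, Measure.smul_apply, Measure.map_apply (measurable_radialProj hK) hA,
    Measure.restrict_apply (measurable_radialProj hK hA), inter_comm, smul_eq_mul]

/-- The measure `⟪z, ν(z)⟫ dH^{n-1}(z)` on the regular boundary. -/
noncomputable def supportMeasure (K : ConvexBody 𝔼) : Measure 𝔼 :=
  (μHE[n - 1].restrict (regularBoundary K)).withDensity
    fun z => ENNReal.ofReal (bodySupport K (gaussMap K z))

theorem supportMeasure_apply {A : Set 𝔼} (hA : MeasurableSet A) (hAS : A ⊆ regularBoundary K) :
    supportMeasure K A = ∫⁻ z in A, ENNReal.ofReal (bodySupport K (gaussMap K z)) ∂μHE[n - 1] := by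
  rw [supportMeasure, withDensity_apply _ hA, Measure.restrict_restrict hA,
    inter_eq_left.2 hAS]

/-- By continuity of the Gauss map, a small piece around z₀ satisfies the hypotheses of
`exists_local_estimate`. One factor t comes from there, the other from replacing the density h(ν(z))
by the constant c = h(ν(z₀)). -/
theorem exists_nhds_measure_comparison (hn : 1 ≤ n) (hK : (0 : 𝔼) ∈ interior (K : Set 𝔼))
    {t : NNReal} (ht : 1 < t) {z₀ : 𝔼} (hz₀ : z₀ ∈ regularBoundary K) :
    ∃ U : Set 𝔼, IsOpen U ∧ z₀ ∈ U ∧ ∀ A, MeasurableSet A → A ⊆ U ∩ regularBoundary K →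
      supportMeasure K A ≤ t * t * coneMeasure K A ∧
      coneMeasure K A ≤ t * t * supportMeasure K A := by
  obtain ⟨ε, hε, hest⟩ := exists_local_estimate hn hK ht
  obtain ⟨ρ, hρ, hpos⟩ := exists_le_inner_normal hK
  set v := gaussMap K z₀ with hv
  set c := bodySupport K v with hc
  have hc0 : 0 < c := by
    rw [hc, bodySupport_gaussMap hz₀]
    exact hρ.trans_le (hpos _ _ (isOuterUnitNormal_gaussMap hz₀))
  have ht' : (1 : ℝ) < t := by exact_mod_cast ht
  have hcont := continuousOn_gaussMap (K := K) z₀ hz₀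
  have hcs : Filter.Tendsto (fun z => bodySupport K (gaussMap K z))
      (nhdsWithin z₀ (regularBoundary K)) (nhds c) :=
    (continuous_bodySupport.tendsto v).comp hcont
  have hin : Filter.Tendsto (fun z : 𝔼 => ⟪v, z⟫) (nhdsWithin z₀ (regularBoundary K)) (nhds c) := by
    rw [hc, bodySupport_gaussMap hz₀, real_inner_comm]
    exact ((by fun_prop : Continuous fun z : 𝔼 => ⟪v, z⟫).tendsto z₀).mono_left nhdsWithin_le_nhds
  have ev1 := hcont.eventually (Metric.closedBall_mem_nhds v hε)
  have ev2 := hin.eventually (Metric.closedBall_mem_nhds c hε)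
  have ev3 := hcs.eventually_lt_const (show c < t * c by nlinarith)
  have ev4 := hcs.eventually_const_lt (show c / t < c from div_lt_self hc0 ht')
  obtain ⟨U, hUo, hzU, hU⟩ := mem_nhdsWithin.1 (((ev1.and ev2).and ev3).and ev4)
  refine ⟨U, hUo, hzU, fun A hA hAU => ?_⟩
  have hU' : ∀ z ∈ A, ‖gaussMap K z - v‖ ≤ ε ∧ |⟪v, z⟫ - c| ≤ ε ∧
      bodySupport K (gaussMap K z) < t * c ∧ c / t < bodySupport K (gaussMap K z) := by
    intro z hz
    obtain ⟨⟨⟨h1, h2⟩, h3⟩, h4⟩ := hU (hAU hz)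
    exact ⟨by simpa [dist_eq_norm] using h1, by simpa [Real.dist_eq] using h2, h3, h4⟩
  have hAS : A ⊆ regularBoundary K := fun z hz => (hAU hz).2
  -- The normal at z gives ⟨ν(z), z' - z⟩ ≤ 0, and replacing ν(z) by v costs at most ε‖z' - z‖.
  -- Exchanging z and z' gives the two-sided bound.
  have hhalf : ∀ z ∈ A, ∀ z' ∈ A, ⟪v, z' - z⟫ ≤ ε * ‖z' - z‖ := by
    intro z hz z' hz'
    have h1 := (isOuterUnitNormal_gaussMap (hAS hz)).2 z' (mem_of_mem_frontier (hAS hz').1)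
    have h2 : ⟪v, z' - z⟫ = (⟪z', gaussMap K z⟫ - ⟪z, gaussMap K z⟫) -
        ⟪gaussMap K z - v, z' - z⟫ := by
      simp only [inner_sub_left, inner_sub_right, real_inner_comm]
      ring
    have h3 := abs_real_inner_le_norm (gaussMap K z - v) (z' - z)
    have h4 := neg_abs_le ⟪gaussMap K z - v, z' - z⟫
    have h5 : ‖gaussMap K z - v‖ * ‖z' - z‖ ≤ ε * ‖z' - z‖ := by
      gcongr
      exact (hU' z hz).1
    linarith
  obtain ⟨e1, e2⟩ := hest v c A (isOuterUnitNormal_gaussMap hz₀).1 hc0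
    (fun z hz => (hAS hz).1) hA
    (fun z hz z' hz' => by
      refine abs_le.2 ⟨?_, hhalf z' hz' z hz⟩
      have h1 := hhalf z hz z' hz'
      rw [← neg_sub z z', inner_neg_right, norm_neg] at h1
      linarith)
    (fun z hz => (hU' z hz).2.1)
  rw [← coneMeasure_apply hK hA] at e1 e2
  have hlow : ENNReal.ofReal c * μHE[n - 1] A ≤ t * supportMeasure K A := by
    rw [supportMeasure_apply hA hAS, ← setLIntegral_const, ← lintegral_const_mul' _ _ (by simp)]
    refine setLIntegral_mono' hA fun z hz => ?_
    rw [← ENNReal.ofReal_coe_nnreal, ← ENNReal.ofReal_mul t.coe_nonneg]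
    refine ENNReal.ofReal_le_ofReal ?_
    have := (hU' z hz).2.2.2
    rw [div_lt_iff₀' (by linarith)] at this
    exact this.le
  have hupp : supportMeasure K A ≤ t * (ENNReal.ofReal c * μHE[n - 1] A) := by
    rw [supportMeasure_apply hA hAS, ← mul_assoc, ← setLIntegral_const]
    refine setLIntegral_mono' hA fun z hz => ?_
    rw [← ENNReal.ofReal_coe_nnreal, ← ENNReal.ofReal_mul t.coe_nonneg]
    exact ENNReal.ofReal_le_ofReal (hU' z hz).2.2.1.le
  constructor
  · calc supportMeasure K A ≤ t * (ENNReal.ofReal c * μHE[n - 1] A) := hupp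
      _ ≤ t * (t * coneMeasure K A) := by gcongr
      _ = _ := by rw [mul_assoc]
  · calc coneMeasure K A ≤ t * (ENNReal.ofReal c * μHE[n - 1] A) := e2
      _ ≤ t * (t * supportMeasure K A) := by gcongr
      _ = _ := by rw [mul_assoc]

/-- On the regular boundary, the cone measure is `⟪z, ν(z)⟫ dH^{n-1}(z)`. -/
theorem coneMeasure_restrict_regularBoundary (hn : 1 ≤ n)
    (hK : (0 : 𝔼) ∈ interior (K : Set 𝔼)) :
    (coneMeasure K).restrict (regularBoundary K) = supportMeasure K := by
  have hS := measurableSet_regularBoundary (K := K)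
  have key : ∀ A, MeasurableSet A → A ⊆ regularBoundary K →
      coneMeasure K A = supportMeasure K A := by
    intro A hA hAS
    apply le_antisymm
    · refine le_of_forall_one_lt_le_sq_mul fun t ht => measure_le_mul_of_locally ?_ hA hAS
      intro z hz
      obtain ⟨U, hU, hzU, h⟩ := exists_nhds_measure_comparison hn hK ht hz
      exact ⟨U, hU, hzU, fun A hA hAU => (h A hA hAU).2⟩
    · refine le_of_forall_one_lt_le_sq_mul fun t ht => measure_le_mul_of_locally ?_ hA hAS
      intro z hz
      obtain ⟨U, hU, hzU, h⟩ := exists_nhds_measure_comparison hn hK ht hz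
      exact ⟨U, hU, hzU, fun A hA hAU => (h A hA hAU).1⟩
  ext A hA
  rw [Measure.restrict_apply hA, key _ (hA.inter hS) inter_subset_right,
    supportMeasure_apply (hA.inter hS) inter_subset_right, supportMeasure,
    withDensity_apply _ hA, Measure.restrict_restrict hA]

end ConeMeasure

/-! ### The gradient of -log f and the support function of f along it -/

section Gradient

variable {n : ℕ}

local notation "𝔼" => EuclideanSpace ℝ (Fin n)

variable {K : ConvexBody (EuclideanSpace ℝ (Fin n))}

/-- Hahn–Banach separates z from the interior of K; the separating functional, normalized, is the
normal. -/
theorem exists_isOuterUnitNormal (hK : (0 : 𝔼) ∈ interior (K : Set 𝔼)) {z : 𝔼}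
    (hz : z ∈ frontier (K : Set 𝔼)) : ∃ v, IsOuterUnitNormal K z v := by
  obtain ⟨g, hg⟩ := geometric_hahn_banach_open_point K.convex.interior isOpen_interior hz.2
  have hle : ∀ y ∈ (K : Set 𝔼), g y ≤ g z := by
    have hcl : closure (interior (K : Set 𝔼)) = K := by
      rw [K.convex.closure_interior_eq_closure_of_nonempty_interior ⟨0, hK⟩, K.isClosed.closure_eq]
    intro y hy
    rw [← hcl] at hy
    exact closure_minimal (fun a ha => (hg a ha).le)
      (isClosed_le g.continuous continuous_const) hy
  set u := (InnerProductSpace.toDual ℝ 𝔼).symm g with hu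
  have hug : ∀ y, ⟪y, u⟫ = g y := fun y => by
    rw [real_inner_comm, hu, InnerProductSpace.toDual_symm_apply]
  have hu0 : u ≠ 0 := by
    intro h
    have := hg 0 hK
    rw [← hug, ← hug, h] at this
    simp at this
  refine ⟨‖u‖⁻¹ • u, ?_, fun y hy => ?_⟩
  · rw [norm_smul, norm_inv, norm_norm, inv_mul_cancel₀ (norm_ne_zero_iff.2 hu0)]
  · rw [inner_smul_right, inner_smul_right, hug, hug]
    exact mul_le_mul_of_nonneg_left (hle y hy) (by positivity)

theorem inner_normal_le (hK : (0 : 𝔼) ∈ interior (K : Set 𝔼)) {z w : 𝔼}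
    (hw : IsOuterUnitNormal K z w) (y : 𝔼) : ⟪y, w⟫ ≤ gauge (K : Set 𝔼) y * ⟪z, w⟫ := by
  rcases eq_or_ne y 0 with rfl | hy
  · simp
  · have h := hw.2 _ (mem_of_mem_frontier (radialProj_mem_frontier hK hy))
    calc ⟪y, w⟫ = gauge (K : Set 𝔼) y * ⟪radialProj K y, w⟫ := by
          rw [← real_inner_smul_left, gauge_smul_radialProj hK]
      _ ≤ _ := mul_le_mul_of_nonneg_left h (gauge_nonneg y)

theorem inner_normal_radialProj (hK : (0 : 𝔼) ∈ interior (K : Set 𝔼)) (x w : 𝔼) :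
    ⟪x, w⟫ = gauge (K : Set 𝔼) x * ⟪radialProj K x, w⟫ := by
  rw [← real_inner_smul_left, gauge_smul_radialProj hK]

/-- The function y ↦ g(y) - ⟨w, y⟩/h is nonnegative and vanishes at y = x, so its derivative there
is zero. -/
theorem gauge_fderiv_apply (hK : (0 : 𝔼) ∈ interior (K : Set 𝔼)) {x w : 𝔼}
    {N' : 𝔼 →L[ℝ] ℝ} (hN : HasFDerivAt (gauge (K : Set 𝔼)) N' x)
    (hw : IsOuterUnitNormal K (radialProj K x) w) (y : 𝔼) :
    N' y = ⟪radialProj K x, w⟫⁻¹ * ⟪w, y⟫ := by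
  obtain ⟨ρ, hρ, hpos⟩ := exists_le_inner_normal hK
  have hh : 0 < ⟪radialProj K x, w⟫ := hρ.trans_le (hpos _ _ hw)
  set h := ⟪radialProj K x, w⟫ with hh'
  have hd : HasFDerivAt (fun y => gauge (K : Set 𝔼) y - h⁻¹ * ⟪w, y⟫)
      (N' - h⁻¹ • innerSL ℝ w) x :=
    hN.sub (((innerSL ℝ w).hasFDerivAt (x := x)).const_mul h⁻¹)
  have hmin : IsLocalMin (fun y => gauge (K : Set 𝔼) y - h⁻¹ * ⟪w, y⟫) x := by
    refine Filter.Eventually.of_forall fun y => ?_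
    have h1 := inner_normal_le hK hw y
    have h2 := inner_normal_radialProj hK x w
    rw [← hh'] at h1 h2
    simp only
    rw [real_inner_comm, h2, real_inner_comm, sub_le_sub_iff, mul_comm _ h,
      inv_mul_cancel_left₀ hh.ne', add_comm, add_le_add_iff_right,
      inv_mul_le_iff₀ hh, mul_comm h]
    exact h1
  have h0 := hmin.hasFDerivAt_eq_zero hd
  have := congrArg (fun T : 𝔼 →L[ℝ] ℝ => T y) h0
  simpa [sub_eq_zero] using this

/-- The derivative of the gauge determines w/⟨z, w⟩ for every normal w at the projected point z;
taking norms then determines w. -/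
theorem radialProj_mem_regularBoundary (hK : (0 : 𝔼) ∈ interior (K : Set 𝔼)) {x : 𝔼}
    (hx : x ≠ 0) (hN : DifferentiableAt ℝ (gauge (K : Set 𝔼)) x) :
    radialProj K x ∈ regularBoundary K := by
  obtain ⟨ρ, hρ, hpos⟩ := exists_le_inner_normal hK
  obtain ⟨v, hv⟩ := exists_isOuterUnitNormal hK (radialProj_mem_frontier hK hx)
  refine ⟨radialProj_mem_frontier hK hx, v, hv, fun w hw => ?_⟩
  have hhv := hρ.trans_le (hpos _ _ hv)
  have hhw := hρ.trans_le (hpos _ _ hw)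
  have hvw : ⟪radialProj K x, w⟫⁻¹ • w = ⟪radialProj K x, v⟫⁻¹ • v := by
    refine ext_inner_right ℝ fun y => ?_
    rw [real_inner_smul_left, real_inner_smul_left, ← gauge_fderiv_apply hK hN.hasFDerivAt hw,
      ← gauge_fderiv_apply hK hN.hasFDerivAt hv]
  have hn := congrArg norm hvw
  rw [norm_smul, norm_smul, hv.1, hw.1, mul_one, mul_one, Real.norm_of_nonneg (by positivity),
    Real.norm_of_nonneg (by positivity)] at hn
  rw [hn] at hvw
  exact smul_right_injective _ (inv_pos.2 hhv).ne' hvw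

theorem ae_differentiable_gauge (hn : 1 ≤ n) (hK : (0 : 𝔼) ∈ interior (K : Set 𝔼)) :
    ∀ᵐ x : 𝔼, x ≠ 0 ∧ DifferentiableAt ℝ (gauge (K : Set 𝔼)) x := by
  -- In positive dimension the origin is a null set; the rest is Rademacher's theorem.
  have : NeZero n := ⟨by omega⟩
  obtain ⟨L, hL⟩ := K.convex.lipschitz_gauge (mem_nhds_zero hK)
  filter_upwards [hL.ae_differentiableAt, Measure.ae_ne volume (0 : 𝔼)] with x h1 h2
  exact ⟨h2, h1⟩

variable {f : EuclideanSpace ℝ (Fin n) → ℝ}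

theorem gradient_neg_log (hK : (0 : 𝔼) ∈ interior (K : Set 𝔼))
    (hf : ∀ x, f x = Real.exp (-(gauge (K : Set 𝔼) x ^ 2 / 2))) {x : 𝔼} (hx : x ≠ 0)
    (hN : DifferentiableAt ℝ (gauge (K : Set 𝔼)) x) :
    gradient (fun y => -Real.log (f y)) x =
      (gauge (K : Set 𝔼) x * (bodySupport K (gaussMap K (radialProj K x)))⁻¹) •
        gaussMap K (radialProj K x) := by
  have hr := radialProj_mem_regularBoundary hK hx hN
  have hlog : (fun y => -Real.log (f y)) = fun y => gauge (K : Set 𝔼) y ^ 2 / 2 := by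
    ext y
    rw [hf, Real.log_exp, neg_neg]
  have hd : HasFDerivAt (fun y => gauge (K : Set 𝔼) y ^ 2 / 2)
      (gauge (K : Set 𝔼) x • fderiv ℝ (gauge (K : Set 𝔼)) x) x := by
    have := (hN.hasFDerivAt.pow 2).mul_const (2⁻¹ : ℝ)
    simp only [← div_eq_mul_inv] at this
    refine this.congr_fderiv ?_
    rw [smul_smul]
    congr 1
    simp
  rw [hlog, gradient, hd.fderiv]
  refine ext_inner_right ℝ fun y => ?_
  rw [InnerProductSpace.toDual_symm_apply, real_inner_smul_left, bodySupport_gaussMap hr, mul_assoc,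
    ← gauge_fderiv_apply hK hN.hasFDerivAt (isOuterUnitNormal_gaussMap hr)]
  rfl

theorem functionSupport_eq_iSup (hf : ∀ x, f x = Real.exp (-(gauge (K : Set 𝔼) x ^ 2 / 2)))
    (q : 𝔼) : functionSupport f q =
      ⨆ y, ((⟪q, y⟫ - gauge (K : Set 𝔼) y ^ 2 / 2 : ℝ) : EReal) := by
  unfold functionSupport
  congr 1
  ext y
  rw [hf, ENNReal.log_ofReal_of_pos (Real.exp_pos _), Real.log_exp, ← EReal.coe_add, sub_eq_add_neg]

theorem measurable_functionSupport
    (hf : ∀ x, f x = Real.exp (-(gauge (K : Set 𝔼) x ^ 2 / 2))) :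
    Measurable (functionSupport f) := by
  have : functionSupport f =
      fun q => ⨆ y, ((⟪q, y⟫ - gauge (K : Set 𝔼) y ^ 2 / 2 : ℝ) : EReal) :=
    funext (functionSupport_eq_iSup hf)
  rw [this]
  refine (lowerSemicontinuous_iSup fun y => Continuous.lowerSemicontinuous ?_).measurable
  exact continuous_coe_real_ereal.comp (by fun_prop)

/-- At ±∞ both sides are 0 by the conventions for `toReal` and for inverses. -/
theorem ereal_toReal_inv (a : EReal) : (a⁻¹).toReal = a.toReal⁻¹ := by
  induction a with
  | bot => simp
  | top => simp
  | coe r => rw [← EReal.coe_inv, EReal.toReal_coe, EReal.toReal_coe]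

theorem measurable_lyzIntegrand
    (hf : ∀ x, f x = Real.exp (-(gauge (K : Set 𝔼) x ^ 2 / 2))) (u : 𝔼) :
    Measurable (lyzIntegrand f u) := by
  unfold lyzIntegrand
  simp_rw [ereal_toReal_inv]
  exact ((by fun_prop : Continuous fun y : 𝔼 => |⟪u, y⟫| ^ 2).measurable).mul
    (measurable_ereal_toReal.comp (measurable_functionSupport hf)).inv

/-- The support function of f is the Legendre transform of g²/2. The upper bound is ab - b²/2 ≤ a²/2
with a = g(x), b = g(y), and the supremum is attained at y = x. -/
theorem functionSupport_gradient (hK : (0 : 𝔼) ∈ interior (K : Set 𝔼))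
    (hf : ∀ x, f x = Real.exp (-(gauge (K : Set 𝔼) x ^ 2 / 2))) {x : 𝔼} (hx : x ≠ 0)
    (hN : DifferentiableAt ℝ (gauge (K : Set 𝔼)) x) :
    functionSupport f (gradient (fun y => -Real.log (f y)) x) =
      ((gauge (K : Set 𝔼) x ^ 2 / 2 : ℝ) : EReal) := by
  obtain ⟨ρ, hρ, hpos⟩ := exists_le_inner_normal hK
  have hr := radialProj_mem_regularBoundary hK hx hN
  have hw := isOuterUnitNormal_gaussMap hr
  have hh := hρ.trans_le (hpos _ _ hw)
  rw [gradient_neg_log hK hf hx hN, functionSupport_eq_iSup hf, bodySupport_gaussMap hr]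
  set w := gaussMap K (radialProj K x)
  set h := ⟪radialProj K x, w⟫ with hh'
  have hx' : ⟪w, x⟫ = gauge (K : Set 𝔼) x * h := by
    rw [real_inner_comm, inner_normal_radialProj hK]
  apply le_antisymm
  · refine iSup_le fun y => EReal.coe_le_coe_iff.2 ?_
    have h1 : ⟪w, y⟫ ≤ gauge (K : Set 𝔼) y * h := by
      rw [real_inner_comm]
      exact inner_normal_le hK hw y
    have h2 : h⁻¹ * ⟪w, y⟫ ≤ gauge (K : Set 𝔼) y := by
      rwa [inv_mul_le_iff₀ hh, mul_comm h]
    rw [real_inner_smul_left, mul_assoc]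
    nlinarith [mul_le_mul_of_nonneg_left h2 (gauge_nonneg (s := (K : Set 𝔼)) x),
      sq_nonneg (gauge (K : Set 𝔼) x - gauge (K : Set 𝔼) y)]
  · refine le_iSup_of_le x (EReal.coe_le_coe_iff.2 (le_of_eq ?_))
    rw [real_inner_smul_left, hx']
    field_simp
    ring

theorem lyzIntegrand_gradient (hK : (0 : 𝔼) ∈ interior (K : Set 𝔼))
    (hf : ∀ x, f x = Real.exp (-(gauge (K : Set 𝔼) x ^ 2 / 2))) (u : 𝔼) {x : 𝔼} (hx : x ≠ 0)
    (hN : DifferentiableAt ℝ (gauge (K : Set 𝔼)) x) :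
    lyzIntegrand f u (gradient (fun y => -Real.log (f y)) x) =
      2 * |⟪u, gaussMap K (radialProj K x)⟫| ^ 2 *
        ((bodySupport K (gaussMap K (radialProj K x)))⁻¹) ^ 2 := by
  have hx0 := (gauge_pos_of_ne_zero hK hx).ne'
  rw [lyzIntegrand, functionSupport_gradient hK hf hx hN, ereal_toReal_inv, EReal.toReal_coe,
    gradient_neg_log hK hf hx hN, inner_smul_right, abs_mul, mul_pow, sq_abs, mul_pow]
  field_simp

theorem measurable_gradient (g : 𝔼 → ℝ) : Measurable (gradient g) :=
  (InnerProductSpace.toDual ℝ 𝔼).symm.continuous.measurable.comp (measurable_fderiv ℝ g)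

end Gradient

/-! ### Radial integration against exp(-g²/2) -/

section Radial

variable {n : ℕ}

local notation "𝔼" => EuclideanSpace ℝ (Fin n)

variable {K : ConvexBody (EuclideanSpace ℝ (Fin n))}

/-- The radial factor `∫₀^∞ s^{n+1} e^{-s²/2} ds`. -/
noncomputable def gaussianMoment (n : ℕ) : ENNReal :=
  ∫⁻ s in Ioi (0 : ℝ), ENNReal.ofReal (s * Real.exp (-(s ^ 2 / 2))) * ENNReal.ofReal (s ^ n)

theorem gaussianMoment_ne_top (n : ℕ) : gaussianMoment n ≠ ⊤ := by
  have h := integrableOn_rpow_mul_exp_neg_mul_sq (b := 1 / 2) (by norm_num)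
    (s := (n + 1 : ℕ)) (by push_cast; linarith [(Nat.cast_nonneg n : (0 : ℝ) ≤ n)])
  refine ne_of_lt (lt_of_eq_of_lt ?_ h.lintegral_lt_top)
  refine setLIntegral_congr_fun measurableSet_Ioi fun s hs => ?_
  have hs : (0 : ℝ) < s := hs
  rw [← ENNReal.ofReal_mul (by positivity), Real.rpow_natCast]
  congr 1
  rw [show -(1 / 2) * s ^ 2 = -(s ^ 2 / 2) by ring]
  ring

theorem gaussianMoment_ne_zero (n : ℕ) : gaussianMoment n ≠ 0 := by
  rw [gaussianMoment, Ne, lintegral_eq_zero_iff (by fun_prop)]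
  intro h
  have h' : ∀ᵐ s : ℝ ∂volume.restrict (Ioi 0), False := by
    filter_upwards [h, ae_restrict_mem measurableSet_Ioi] with s h1 hs
    have hs : (0 : ℝ) < s := hs
    have h2 : 0 < ENNReal.ofReal (s * Real.exp (-(s ^ 2 / 2))) * ENNReal.ofReal (s ^ n) :=
      ENNReal.mul_pos (by simp; positivity) (by simp; positivity)
    exact h2.ne' h1
  rw [Filter.eventually_false_iff_eq_bot, ae_eq_bot, Measure.restrict_eq_zero,
    Real.volume_Ioi] at h'
  exact ENNReal.top_ne_zero h'

/-- The layer-cake form of the Gaussian: s exp(-s²/2) is the derivative of -exp(-s²/2). -/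
theorem ofReal_exp_eq_lintegral {r : ℝ} (hr : 0 ≤ r) :
    ENNReal.ofReal (Real.exp (-(r ^ 2 / 2))) =
      ∫⁻ s in Ioi (0 : ℝ), (Ici r).indicator
        (fun s => ENNReal.ofReal (s * Real.exp (-(s ^ 2 / 2)))) s := by
  have hd : ∀ s : ℝ, HasDerivAt (fun s => -Real.exp (-(s ^ 2 / 2)))
      (s * Real.exp (-(s ^ 2 / 2))) s := by
    intro s
    have h1 : HasDerivAt (fun s : ℝ => -(s ^ 2 / 2)) (-s) s := by
      refine (((hasDerivAt_id s).pow 2).div_const 2).neg.congr_deriv ?_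
      simp
    refine h1.exp.neg.congr_deriv ?_
    ring
  have hlim : Filter.Tendsto (fun s : ℝ => -Real.exp (-(s ^ 2 / 2))) Filter.atTop (nhds 0) := by
    rw [← neg_zero]
    refine (Real.tendsto_exp_neg_atTop_nhds_zero.comp ?_).neg
    exact (Filter.tendsto_pow_atTop two_ne_zero).atTop_div_const two_pos
  have hpos : ∀ s ∈ Ioi r, 0 ≤ s * Real.exp (-(s ^ 2 / 2)) := fun s hs =>
    mul_nonneg (hr.trans (le_of_lt hs)) (Real.exp_pos _).le
  have hint := integral_Ioi_of_hasDerivAt_of_nonneg' (a := r) (fun s _ => hd s) hpos hlim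
  have hintg := integrableOn_Ioi_deriv_of_nonneg' (a := r) (fun s _ => hd s) hpos hlim
  rw [zero_sub, neg_neg] at hint
  rw [← hint, ofReal_integral_eq_lintegral_ofReal hintg
    ((ae_restrict_mem measurableSet_Ioi).mono hpos), lintegral_indicator measurableSet_Ici,
    Measure.restrict_restrict measurableSet_Ici]
  refine setLIntegral_congr ?_
  refine Filter.EventuallyEq.trans Ioi_ae_eq_Ici ?_
  rcases hr.eq_or_lt with rfl | hr
  · rw [inter_eq_right.2 Ioi_subset_Ici_self]
    exact Ioi_ae_eq_Ici.symm
  · rw [inter_eq_left.2 (Ici_subset_Ioi.2 hr)]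
    rfl

/-- The sublevel set is the dilate sK, so the substitution x ↦ sx produces the factor sⁿ and leaves
G unchanged. -/
theorem setLIntegral_gauge_le (hK : (0 : 𝔼) ∈ interior (K : Set 𝔼)) {G : 𝔼 → ENNReal}
    (hG : Measurable G) (hom : ∀ r : ℝ, 0 < r → ∀ x, G (r • x) = G x) {s : ℝ} (hs : 0 < s) :
    ∫⁻ x in {x | gauge (K : Set 𝔼) x ≤ s}, G x =
      ENNReal.ofReal (s ^ n) * ∫⁻ x in (K : Set 𝔼), G x := by
  have hKm : MeasurableSet (K : Set 𝔼) := K.isClosed.measurableSet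
  have hsm : MeasurableSet {x | gauge (K : Set 𝔼) x ≤ s} :=
    measurableSet_le (continuous_gauge_body hK).measurable measurable_const
  have hmap := Measure.map_addHaar_smul (volume : Measure 𝔼) hs.ne'
  rw [finrank_euclideanSpace_fin, abs_of_pos (by positivity)] at hmap
  have h1 : ∫⁻ x in (K : Set 𝔼), G x =
      ENNReal.ofReal (s ^ n)⁻¹ * ∫⁻ x in {x | gauge (K : Set 𝔼) x ≤ s}, G x := by
    rw [← smul_eq_mul, ← lintegral_smul_measure, ← Measure.restrict_smul, ← hmap,
      ← lintegral_indicator hsm, lintegral_map (hG.indicator hsm) (by fun_prop),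
      ← lintegral_indicator hKm]
    refine lintegral_congr fun x => ?_
    have hiff : s • x ∈ {x | gauge (K : Set 𝔼) x ≤ s} ↔ x ∈ (K : Set 𝔼) := by
      rw [mem_ofPred_eq, gauge_smul_of_nonneg hs.le, smul_eq_mul, ← gauge_le_one_iff hK]
      exact mul_le_iff_le_one_right hs
    by_cases hx : x ∈ (K : Set 𝔼)
    · rw [indicator_of_mem hx, indicator_of_mem (hiff.2 hx), hom s hs]
    · rw [indicator_of_notMem hx, indicator_of_notMem (fun h => hx (hiff.1 h))]
  rw [h1, ← mul_assoc, ← ENNReal.ofReal_mul (by positivity), mul_inv_cancel₀ (by positivity),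
    ENNReal.ofReal_one, one_mul]

/-- Integration of a `0`-homogeneous function against `e^{-‖x‖_K²/2}`. -/
theorem lintegral_exp_gauge_mul (hK : (0 : 𝔼) ∈ interior (K : Set 𝔼)) {G : 𝔼 → ENNReal}
    (hG : Measurable G) (hom : ∀ r : ℝ, 0 < r → ∀ x, G (r • x) = G x) :
    ∫⁻ x, ENNReal.ofReal (Real.exp (-(gauge (K : Set 𝔼) x ^ 2 / 2))) * G x =
      gaussianMoment n * ∫⁻ x in (K : Set 𝔼), G x := by
  have hgm := (continuous_gauge_body hK).measurable
  have hset : MeasurableSet {p : 𝔼 × ℝ | gauge (K : Set 𝔼) p.1 ≤ p.2} :=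
    measurableSet_le (hgm.comp measurable_fst) measurable_snd
  have hF : Measurable (Function.uncurry fun (x : 𝔼) (s : ℝ) =>
      (Ici (gauge (K : Set 𝔼) x)).indicator
        (fun s => ENNReal.ofReal (s * Real.exp (-(s ^ 2 / 2)))) s * G x) := by
    refine Measurable.mul ?_ (hG.comp measurable_fst)
    have : Measurable ({p : 𝔼 × ℝ | gauge (K : Set 𝔼) p.1 ≤ p.2}.indicator fun p : 𝔼 × ℝ =>
        ENNReal.ofReal (p.2 * Real.exp (-(p.2 ^ 2 / 2)))) :=
      Measurable.indicator (by fun_prop) hset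
    exact this
  -- The layer-cake formula and Tonelli reduce the integral to sublevel sets of the gauge.
  calc ∫⁻ x, ENNReal.ofReal (Real.exp (-(gauge (K : Set 𝔼) x ^ 2 / 2))) * G x
      = ∫⁻ x, ∫⁻ s in Ioi (0 : ℝ), (Ici (gauge (K : Set 𝔼) x)).indicator
        (fun s => ENNReal.ofReal (s * Real.exp (-(s ^ 2 / 2)))) s * G x := by
        refine lintegral_congr fun x => ?_
        rw [ofReal_exp_eq_lintegral (gauge_nonneg x), lintegral_mul_const _
          (Measurable.indicator (by fun_prop) measurableSet_Ici)]
    _ = ∫⁻ s in Ioi (0 : ℝ), ∫⁻ x, (Ici (gauge (K : Set 𝔼) x)).indicator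
        (fun s => ENNReal.ofReal (s * Real.exp (-(s ^ 2 / 2)))) s * G x :=
        lintegral_lintegral_swap hF.aemeasurable
    _ = ∫⁻ s in Ioi (0 : ℝ), (ENNReal.ofReal (s * Real.exp (-(s ^ 2 / 2))) *
          ENNReal.ofReal (s ^ n)) * ∫⁻ x in (K : Set 𝔼), G x := by
        refine setLIntegral_congr_fun measurableSet_Ioi fun s hs => ?_
        have hsm : MeasurableSet {x | gauge (K : Set 𝔼) x ≤ s} :=
          measurableSet_le hgm measurable_const
        rw [mul_assoc, ← setLIntegral_gauge_le hK hG hom hs, ← lintegral_const_mul _ hG,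
          ← lintegral_indicator hsm]
        refine lintegral_congr fun x => ?_
        by_cases hx : gauge (K : Set 𝔼) x ≤ s
        · rw [indicator_of_mem (by exact hx), indicator_of_mem (by exact hx)]
        · rw [indicator_of_notMem (by exact hx), indicator_of_notMem (by exact hx), zero_mul]
    _ = _ := by rw [lintegral_mul_const _ (by fun_prop), gaussianMoment]

end Radial

/-! ### From integrals over K to integrals against the L₂ surface area measure -/

section Surface

variable {n : ℕ}

local notation "𝔼" => EuclideanSpace ℝ (Fin n)

variable {K : ConvexBody (EuclideanSpace ℝ (Fin n))}

theorem aemeasurable_gaussMap :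
    AEMeasurable (gaussMap K) (μHE[n - 1].restrict (regularBoundary K)) :=
  continuousOn_gaussMap.aemeasurable measurableSet_regularBoundary

theorem setLIntegral_surfaceAreaMeasureTwo {F : 𝔼 → ENNReal} (hF : Measurable F) :
    ∫⁻ v in Metric.sphere 0 1, F v ∂(surfaceAreaMeasureTwo K) =
      ∫⁻ z in regularBoundary K, ENNReal.ofReal (bodySupport K (gaussMap K z))⁻¹ *
        F (gaussMap K z) ∂μHE[n - 1] := by
  have hsm : MeasurableSet (Metric.sphere (0 : 𝔼) 1) := Metric.isClosed_sphere.measurableSet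
  have hhm : Measurable fun v => ENNReal.ofReal (bodySupport K v)⁻¹ :=
    continuous_bodySupport.measurable.inv.ennreal_ofReal
  rw [← lintegral_indicator hsm, surfaceAreaMeasureTwo,
    lintegral_withDensity_eq_lintegral_mul _ hhm (hF.indicator hsm), surfaceAreaMeasure,
    lintegral_map' (hhm.mul (hF.indicator hsm)).aemeasurable aemeasurable_gaussMap]
  refine setLIntegral_congr_fun measurableSet_regularBoundary fun z hz => ?_
  have hmem : gaussMap K z ∈ Metric.sphere (0 : 𝔼) 1 := by
    simpa using (isOuterUnitNormal_gaussMap hz).1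
  rw [Pi.mul_apply, indicator_of_mem hmem]

/-- The function `2 ⟪u, ν(z)⟫² h(ν(z))⁻²` on the regular boundary. -/
noncomputable def boundaryIntegrand (K : ConvexBody 𝔼) (u : 𝔼) : 𝔼 → ENNReal :=
  (regularBoundary K).indicator fun z =>
    ENNReal.ofReal (2 * |⟪u, gaussMap K z⟫| ^ 2 * ((bodySupport K (gaussMap K z))⁻¹) ^ 2)

theorem measurable_boundaryIntegrand (hK : (0 : 𝔼) ∈ interior (K : Set 𝔼)) (u : 𝔼) :
    Measurable (boundaryIntegrand K u) := by
  obtain ⟨ρ, hρ, hpos⟩ := exists_le_inner_normal hK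
  have hν := continuousOn_gaussMap (K := K)
  have hh : ContinuousOn (fun z => (bodySupport K (gaussMap K z))⁻¹) (regularBoundary K) := by
    refine (continuous_bodySupport.comp_continuousOn hν).inv₀ fun z hz => ?_
    rw [Function.comp_apply, bodySupport_gaussMap hz]
    exact (hρ.trans_le (hpos _ _ (isOuterUnitNormal_gaussMap hz))).ne'
  have hc : ContinuousOn (fun z => ENNReal.ofReal
      (2 * |⟪u, gaussMap K z⟫| ^ 2 * ((bodySupport K (gaussMap K z))⁻¹) ^ 2))
      (regularBoundary K) := by
    refine ENNReal.continuous_ofReal.comp_continuousOn ?_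
    exact (continuousOn_const.mul ((continuousOn_const.inner hν).abs.pow 2)).mul (hh.pow 2)
  classical
  rw [boundaryIntegrand, ← piecewise_eq_indicator]
  exact hc.measurable_piecewise continuousOn_const measurableSet_regularBoundary

/-- The left side is an integral against the cone measure, whose density h(ν) turns 2⟨u,ν⟩²h⁻² into
2⟨u,ν⟩²h⁻¹. The indicator in `boundaryIntegrand` discards irregular boundary points, so their
H^{n-1}-measure plays no role. -/
theorem lintegral_boundaryIntegrand (hn : 1 ≤ n) (hK : (0 : 𝔼) ∈ interior (K : Set 𝔼)) (u : 𝔼) :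
    n * ∫⁻ x in (K : Set 𝔼), boundaryIntegrand K u (radialProj K x) =
      2 * ∫⁻ v in Metric.sphere 0 1, ENNReal.ofReal (|⟪u, v⟫| ^ 2) ∂(surfaceAreaMeasureTwo K) := by
  obtain ⟨ρ, hρ, hpos⟩ := exists_le_inner_normal hK
  have hS := measurableSet_regularBoundary (K := K)
  have hg := measurable_boundaryIntegrand hK u
  have hd : AEMeasurable (fun z => ENNReal.ofReal (bodySupport K (gaussMap K z)))
      (μHE[n - 1].restrict (regularBoundary K)) :=
    (continuous_bodySupport.measurable.comp_aemeasurable aemeasurable_gaussMap).ennreal_ofReal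
  have h1 : n * ∫⁻ x in (K : Set 𝔼), boundaryIntegrand K u (radialProj K x) =
      ∫⁻ z, boundaryIntegrand K u z ∂(coneMeasure K) := by
    rw [coneMeasure, lintegral_smul_measure, lintegral_map hg (measurable_radialProj hK),
      smul_eq_mul]
  have h2 : ∫⁻ z, boundaryIntegrand K u z ∂(coneMeasure K) =
      ∫⁻ z, boundaryIntegrand K u z ∂(supportMeasure K) := by
    rw [← coneMeasure_restrict_regularBoundary hn hK, ← lintegral_indicator hS, boundaryIntegrand,
      indicator_indicator, inter_self]
  rw [h1, h2, supportMeasure, lintegral_withDensity_eq_lintegral_mul₀ hd hg.aemeasurable,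
    setLIntegral_surfaceAreaMeasureTwo (by fun_prop), ← lintegral_const_mul' _ _ (by simp)]
  refine setLIntegral_congr_fun hS fun z hz => ?_
  have hh : 0 < bodySupport K (gaussMap K z) := by
    rw [bodySupport_gaussMap hz]
    exact hρ.trans_le (hpos _ _ (isOuterUnitNormal_gaussMap hz))
  rw [Pi.mul_apply, boundaryIntegrand, indicator_of_mem hz, ← ENNReal.ofReal_mul hh.le,
    ← ENNReal.ofReal_mul (by positivity)]
  set h := bodySupport K (gaussMap K z)
  set a := |⟪u, gaussMap K z⟫|
  rw [show h * (2 * a ^ 2 * h⁻¹ ^ 2) = 2 * (h⁻¹ * a ^ 2) by field_simp,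
    ENNReal.ofReal_mul two_pos.le, ENNReal.ofReal_ofNat]

theorem setLIntegral_boundaryIntegrand_lt_top (hK : (0 : 𝔼) ∈ interior (K : Set 𝔼)) (u : 𝔼) :
    ∫⁻ x in (K : Set 𝔼), boundaryIntegrand K u (radialProj K x) < ⊤ := by
  obtain ⟨ρ, hρ, hpos⟩ := exists_le_inner_normal hK
  refine setLIntegral_lt_top_of_le_nnreal K.isCompact.measure_lt_top.ne
    ⟨Real.toNNReal (2 * ‖u‖ ^ 2 * (ρ⁻¹) ^ 2), fun x _ => ?_⟩
  by_cases hz : radialProj K x ∈ regularBoundary K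
  swap
  · rw [boundaryIntegrand, indicator_of_notMem hz]
    exact bot_le
  rw [boundaryIntegrand, indicator_of_mem hz]
  have hw := isOuterUnitNormal_gaussMap hz
  have h1 := hpos _ _ hw
  rw [bodySupport_gaussMap hz]
  refine ENNReal.ofReal_le_ofReal ?_
  have h2 : |⟪u, gaussMap K (radialProj K x)⟫| ≤ ‖u‖ := by
    simpa [hw.1] using abs_real_inner_le_norm u (gaussMap K (radialProj K x))
  have h3 : 0 < ⟪radialProj K x, gaussMap K (radialProj K x)⟫ := hρ.trans_le h1
  gcongr

/-- Let z₁ be the boundary point in direction u. At a regular boundary point z within ρ of z₁, the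
bound ⟨z, ν(z)⟩ ≥ ρ forces ⟨z₁, ν(z)⟩ > 0, so the integrand is positive almost everywhere on a
nonempty open set. -/
theorem setLIntegral_boundaryIntegrand_pos (hn : 1 ≤ n) (hK : (0 : 𝔼) ∈ interior (K : Set 𝔼))
    {u : 𝔼} (hu : u ≠ 0) :
    0 < ∫⁻ x in (K : Set 𝔼), boundaryIntegrand K u (radialProj K x) := by
  obtain ⟨ρ, hρ, hpos⟩ := exists_le_inner_normal hK
  have hgm : Measurable fun x => boundaryIntegrand K u (radialProj K x) :=
    (measurable_boundaryIntegrand hK u).comp (measurable_radialProj hK)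
  have hNc := continuous_gauge_body hK
  have hNu := gauge_pos_of_ne_zero hK hu
  set z₁ := radialProj K u with hz₁
  have hN1 : gauge (K : Set 𝔼) z₁ = 1 := gauge_radialProj hK hu
  -- The condition that the radial projection of x lies within ρ of z₁, multiplied by g(x) so that
  -- it is visibly open.
  let O : Set 𝔼 := interior (K : Set 𝔼) ∩ {x | ‖x - gauge (K : Set 𝔼) x • z₁‖ <
    ρ * gauge (K : Set 𝔼) x}
  have hO : IsOpen O := isOpen_interior.inter (isOpen_lt (by fun_prop) (by fun_prop))
  have hOne : O.Nonempty := by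
    refine ⟨(1 / 2 : ℝ) • z₁, ?_, ?_⟩
    · rw [← gauge_lt_one_iff_mem_interior K.convex (mem_nhds_zero hK),
        gauge_smul_of_nonneg (by norm_num), hN1]
      norm_num
    · rw [mem_ofPred_eq, gauge_smul_of_nonneg (by norm_num), hN1]
      simp [hρ]
  by_contra h0
  have h0 := le_zero_iff.1 (not_lt.1 h0)
  rw [lintegral_eq_zero_iff hgm, Filter.EventuallyEq,
    ae_restrict_iff' K.isClosed.measurableSet] at h0
  have hae : ∀ᵐ x : 𝔼, x ∉ O := by
    filter_upwards [h0, ae_differentiable_gauge hn hK] with x hx ⟨hx0, hxd⟩ hxO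
    have hr := radialProj_mem_regularBoundary hK hx0 hxd
    have hw := isOuterUnitNormal_gaussMap hr
    have h1 := hx (interior_subset hxO.1)
    rw [boundaryIntegrand, indicator_of_mem hr, Pi.zero_apply,
      ENNReal.ofReal_eq_zero, bodySupport_gaussMap hr] at h1
    have h2 := hpos _ _ hw
    have hNx := gauge_pos_of_ne_zero hK hx0
    set w := gaussMap K (radialProj K x)
    have h3 : ‖radialProj K x - z₁‖ < ρ := by
      have h4 : x - gauge (K : Set 𝔼) x • z₁ =
          gauge (K : Set 𝔼) x • (radialProj K x - z₁) := by
        rw [smul_sub, gauge_smul_radialProj hK]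
      have h5 := hxO.2
      rw [mem_ofPred_eq, h4, norm_smul, Real.norm_of_nonneg hNx.le, mul_comm] at h5
      exact lt_of_mul_lt_mul_right h5 hNx.le
    have h4 : 0 < ⟪z₁, w⟫ := by
      have h5 := real_inner_le_norm (radialProj K x - z₁) w
      rw [hw.1, mul_one, inner_sub_left] at h5
      linarith
    have h5 : 0 < ⟪u, w⟫ := by
      rw [inner_normal_radialProj hK]
      exact mul_pos hNu h4
    have h6 : 0 < ⟪radialProj K x, w⟫ := hρ.trans_le h2
    exact absurd h1 (not_le.2 (by positivity))
  exact (hO.measure_pos volume hOne).ne' (measure_eq_zero_iff_ae_notMem.2 hae)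

end Surface

/-! ### The functional integral and its normalization -/

section Functional

variable {n : ℕ}

local notation "𝔼" => EuclideanSpace ℝ (Fin n)

variable {K : ConvexBody (EuclideanSpace ℝ (Fin n))} {f : EuclideanSpace ℝ (Fin n) → ℝ}

theorem lyzIntegrand_nonneg_gradient (hn : 1 ≤ n) (hK : (0 : 𝔼) ∈ interior (K : Set 𝔼))
    (hf : ∀ x, f x = Real.exp (-(gauge (K : Set 𝔼) x ^ 2 / 2))) (u : 𝔼) :
    ∀ᵐ y ∂(functionSurfaceMeasure f), 0 ≤ lyzIntegrand f u y := by
  have hfm : Measurable f := by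
    rw [show f = _ from funext hf]
    exact (by have := continuous_gauge_body hK; fun_prop : Continuous _).measurable
  rw [functionSurfaceMeasure, ae_map_iff (measurable_gradient _).aemeasurable
    (measurableSet_le measurable_const (measurable_lyzIntegrand hf u))]
  refine (withDensity_absolutelyContinuous _ _).ae_le ?_
  filter_upwards [ae_differentiable_gauge hn hK] with x ⟨hx0, hxd⟩
  rw [lyzIntegrand_gradient hK hf u hx0 hxd]
  positivity

/-- Pulled back along the gradient, the integrand is almost everywhere the 0-homogeneous function
`boundaryIntegrand K u ∘ radialProj K`, to which `lintegral_exp_gauge_mul` applies. -/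
theorem lintegral_lyzIntegrand (hn : 1 ≤ n) (hK : (0 : 𝔼) ∈ interior (K : Set 𝔼))
    (hf : ∀ x, f x = Real.exp (-(gauge (K : Set 𝔼) x ^ 2 / 2))) (u : 𝔼) :
    ∫⁻ y, ENNReal.ofReal (lyzIntegrand f u y) ∂(functionSurfaceMeasure f) =
      gaussianMoment n * ∫⁻ x in (K : Set 𝔼), boundaryIntegrand K u (radialProj K x) := by
  have hfm : Measurable f := by
    rw [show f = _ from funext hf]
    exact (by have := continuous_gauge_body hK; fun_prop : Continuous _).measurable
  have hlm := (measurable_lyzIntegrand hf u).ennreal_ofReal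
  have hlg : Measurable fun x =>
      ENNReal.ofReal (lyzIntegrand f u (gradient (fun y => -Real.log (f y)) x)) :=
    hlm.comp (measurable_gradient _)
  have hgm : Measurable fun x => boundaryIntegrand K u (radialProj K x) :=
    (measurable_boundaryIntegrand hK u).comp (measurable_radialProj hK)
  rw [functionSurfaceMeasure, lintegral_map hlm (measurable_gradient _),
    lintegral_withDensity_eq_lintegral_mul _ hfm.ennreal_ofReal hlg,
    ← lintegral_exp_gauge_mul hK hgm (fun r hr x => by rw [radialProj_smul hr])]
  refine lintegral_congr_ae ?_
  filter_upwards [ae_differentiable_gauge hn hK] with x ⟨hx0, hxd⟩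
  rw [Pi.mul_apply, hf, lyzIntegrand_gradient hK hf u hx0 hxd, boundaryIntegrand,
    indicator_of_mem (radialProj_mem_regularBoundary hK hx0 hxd)]

theorem lintegral_ofReal_function (hK : (0 : 𝔼) ∈ interior (K : Set 𝔼))
    (hf : ∀ x, f x = Real.exp (-(gauge (K : Set 𝔼) x ^ 2 / 2))) :
    ∫⁻ x, ENNReal.ofReal (f x) = gaussianMoment n * volume (K : Set 𝔼) := by
  have := lintegral_exp_gauge_mul hK (G := fun _ => 1) measurable_const (fun _ _ _ => rfl)
  simpa [hf] using this

theorem integrable_function (hK : (0 : 𝔼) ∈ interior (K : Set 𝔼))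
    (hf : ∀ x, f x = Real.exp (-(gauge (K : Set 𝔼) x ^ 2 / 2))) : Integrable f := by
  have hfc : Continuous f := by
    have := continuous_gauge_body hK
    rw [show f = _ from funext hf]
    fun_prop
  have hf0 : 0 ≤ᵐ[volume] f := Filter.Eventually.of_forall fun x => by
    rw [hf]
    exact (Real.exp_pos _).le
  refine ⟨hfc.aestronglyMeasurable, ?_⟩
  rw [hasFiniteIntegral_iff_ofReal hf0, lintegral_ofReal_function hK hf]
  exact ENNReal.mul_lt_top (gaussianMoment_ne_top n).lt_top K.isCompact.measure_lt_top

theorem totalMass_eq (hK : (0 : 𝔼) ∈ interior (K : Set 𝔼))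
    (hf : ∀ x, f x = Real.exp (-(gauge (K : Set 𝔼) x ^ 2 / 2))) :
    totalMass f = (gaussianMoment n).toReal * volume.real (K : Set 𝔼) := by
  have hf0 : 0 ≤ᵐ[volume] f := Filter.Eventually.of_forall fun x => by
    rw [hf]
    exact (Real.exp_pos _).le
  rw [totalMass, integral_eq_lintegral_of_nonneg_ae hf0
    (integrable_function hK hf).aestronglyMeasurable, lintegral_ofReal_function hK hf,
    ENNReal.toReal_mul, Measure.real]

theorem gaussianMoment_toReal_pos (n : ℕ) : 0 < (gaussianMoment n).toReal :=
  ENNReal.toReal_pos (gaussianMoment_ne_zero n) (gaussianMoment_ne_top n)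

theorem volume_real_pos (hK : (0 : 𝔼) ∈ interior (K : Set 𝔼)) :
    0 < volume.real (K : Set 𝔼) :=
  ENNReal.toReal_pos (Measure.measure_pos_of_mem_nhds volume (mem_nhds_zero hK)).ne'
    K.isCompact.measure_lt_top.ne

theorem integrable_lyzIntegrand (hn : 1 ≤ n) (hK : (0 : 𝔼) ∈ interior (K : Set 𝔼))
    (hf : ∀ x, f x = Real.exp (-(gauge (K : Set 𝔼) x ^ 2 / 2))) (u : 𝔼) :
    Integrable (lyzIntegrand f u) (functionSurfaceMeasure f) := by
  refine ⟨(measurable_lyzIntegrand hf u).aestronglyMeasurable, ?_⟩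
  rw [hasFiniteIntegral_iff_ofReal (lyzIntegrand_nonneg_gradient hn hK hf u),
    lintegral_lyzIntegrand hn hK hf u]
  exact ENNReal.mul_lt_top (gaussianMoment_ne_top n).lt_top
    (setLIntegral_boundaryIntegrand_lt_top hK u)

theorem setLIntegral_inner_sq_lt_top (hn : 1 ≤ n) (hK : (0 : 𝔼) ∈ interior (K : Set 𝔼)) (u : 𝔼) :
    ∫⁻ v in Metric.sphere 0 1, ENNReal.ofReal (|⟪u, v⟫| ^ 2) ∂(surfaceAreaMeasureTwo K) < ⊤ := by
  have h := lintegral_boundaryIntegrand hn hK u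
  have hlt : (n : ENNReal) * ∫⁻ x in (K : Set 𝔼), boundaryIntegrand K u (radialProj K x) < ⊤ :=
    ENNReal.mul_lt_top (ENNReal.natCast_lt_top n) (setLIntegral_boundaryIntegrand_lt_top hK u)
  rw [h] at hlt
  exact ENNReal.lt_top_of_mul_ne_top_right hlt.ne two_ne_zero

theorem integrableOn_inner_sq (hn : 1 ≤ n) (hK : (0 : 𝔼) ∈ interior (K : Set 𝔼)) (u : 𝔼) :
    IntegrableOn (fun v => |⟪u, v⟫| ^ 2) (Metric.sphere 0 1) (surfaceAreaMeasureTwo K) := by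
  refine ⟨(by fun_prop : Continuous fun v : 𝔼 => |⟪u, v⟫| ^ 2).aestronglyMeasurable, ?_⟩
  rw [hasFiniteIntegral_iff_ofReal (Filter.Eventually.of_forall fun v => by positivity)]
  exact setLIntegral_inner_sq_lt_top hn hK u

theorem setIntegral_inner_sq_eq (u : 𝔼) :
    ∫ v in Metric.sphere 0 1, |⟪u, v⟫| ^ 2 ∂(surfaceAreaMeasureTwo K) =
      (∫⁻ v in Metric.sphere 0 1, ENNReal.ofReal (|⟪u, v⟫| ^ 2)
        ∂(surfaceAreaMeasureTwo K)).toReal :=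
  integral_eq_lintegral_of_nonneg_ae (Filter.Eventually.of_forall fun v => by positivity)
    (by fun_prop : Continuous fun v : 𝔼 => |⟪u, v⟫| ^ 2).aestronglyMeasurable

theorem setIntegral_inner_sq_pos (hn : 1 ≤ n) (hK : (0 : 𝔼) ∈ interior (K : Set 𝔼)) {u : 𝔼}
    (hu : u ≠ 0) :
    0 < ∫ v in Metric.sphere 0 1, |⟪u, v⟫| ^ 2 ∂(surfaceAreaMeasureTwo K) := by
  rw [setIntegral_inner_sq_eq]
  refine ENNReal.toReal_pos (fun h0 => ?_) (setLIntegral_inner_sq_lt_top hn hK u).ne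
  have h := lintegral_boundaryIntegrand hn hK u
  rw [h0, mul_zero, mul_eq_zero, Nat.cast_eq_zero] at h
  rcases h with h | h
  · omega
  · exact (setLIntegral_boundaryIntegrand_pos hn hK hu).ne' h

theorem integral_lyzIntegrand (hn : 1 ≤ n) (hK : (0 : 𝔼) ∈ interior (K : Set 𝔼))
    (hf : ∀ x, f x = Real.exp (-(gauge (K : Set 𝔼) x ^ 2 / 2))) (u : 𝔼) :
    n * ∫ y, lyzIntegrand f u y ∂(functionSurfaceMeasure f) =
      2 * (gaussianMoment n).toReal *
        ∫ v in Metric.sphere 0 1, |⟪u, v⟫| ^ 2 ∂(surfaceAreaMeasureTwo K) := by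
  have h := congrArg ENNReal.toReal (lintegral_boundaryIntegrand hn hK u)
  rw [ENNReal.toReal_mul, ENNReal.toReal_mul, ENNReal.toReal_natCast, ENNReal.toReal_ofNat,
    ← setIntegral_inner_sq_eq] at h
  rw [integral_eq_lintegral_of_nonneg_ae (lyzIntegrand_nonneg_gradient hn hK hf u)
    (measurable_lyzIntegrand hf u).aestronglyMeasurable, lintegral_lyzIntegrand hn hK hf u,
    ENNReal.toReal_mul, mul_left_comm, h]
  ring

/-- The Gaussian moment cancels between the integral and J(f), and the constants combine to 2/4 =
1/2. -/
theorem neg_log_functionalLYZ (hn : 1 ≤ n) (hK : (0 : 𝔼) ∈ interior (K : Set 𝔼))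
    (hf : ∀ x, f x = Real.exp (-(gauge (K : Set 𝔼) x ^ 2 / 2))) (u : 𝔼) :
    (n : ℝ) / (4 * totalMass f) * ∫ y, lyzIntegrand f u y ∂(functionSurfaceMeasure f) =
      (1 / volume.real (K : Set 𝔼) *
        ∫ v in Metric.sphere 0 1, |⟪u, v⟫| ^ 2 ∂(surfaceAreaMeasureTwo K)) / 2 := by
  rw [div_mul_eq_mul_div, integral_lyzIntegrand hn hK hf u, totalMass_eq hK hf]
  have h1 := (gaussianMoment_toReal_pos n).ne'
  have h2 := (volume_real_pos hK).ne'
  field_simp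
  ring

end Functional

/-! ### The gauge of the LYZ ellipsoid as the root of a quadratic form -/

section Ellipsoid

variable {n : ℕ}

local notation "𝔼" => EuclideanSpace ℝ (Fin n)

variable {K : ConvexBody (EuclideanSpace ℝ (Fin n))}

/-- The quadratic form `V(K)⁻¹ ∫ ⟪u, v⟫² dS₂(K, v)` of the LYZ ellipsoid. -/
noncomputable def lyzForm (K : ConvexBody 𝔼) (u : 𝔼) : ℝ :=
  1 / volume.real (K : Set 𝔼) *
    ∫ v in Metric.sphere 0 1, |⟪u, v⟫| ^ 2 ∂(surfaceAreaMeasureTwo K)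

theorem lyzForm_smul (r : ℝ) (u : 𝔼) : lyzForm K (r • u) = r ^ 2 * lyzForm K u := by
  simp only [lyzForm, real_inner_smul_left, abs_mul, mul_pow, sq_abs, integral_const_mul]
  ring

theorem lyzForm_pos (hn : 1 ≤ n) (hK : (0 : 𝔼) ∈ interior (K : Set 𝔼)) {u : 𝔼} (hu : u ≠ 0) :
    0 < lyzForm K u :=
  mul_pos (one_div_pos.2 (volume_real_pos hK)) (setIntegral_inner_sq_pos hn hK hu)

theorem mem_lyzEllipsoid_iff (hn : 1 ≤ n) (hK : (0 : 𝔼) ∈ interior (K : Set 𝔼)) (x : 𝔼) :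
    x ∈ lyzEllipsoid K ↔ lyzForm K x ≤ 1 := by
  have hray : ∀ u : 𝔼, ‖u‖ = 1 → ∀ t : ℝ, 0 ≤ t →
      (t ≤ lyzRadial K u ↔ lyzForm K (t • u) ≤ 1) := by
    intro u hu t ht
    have hq : 0 < lyzForm K u := lyzForm_pos hn hK (by rintro rfl; simp at hu)
    have hsq := Real.sqrt_pos.2 hq
    rw [show lyzRadial K u = (√(lyzForm K u))⁻¹ from rfl, ← one_div, le_div_iff₀ hsq,
      lyzForm_smul, ← Real.sqrt_le_one (x := t ^ 2 * lyzForm K u), Real.sqrt_mul (sq_nonneg t), Real.sqrt_sq ht]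
  constructor
  · rintro ⟨u, hu, t, ht, htu, rfl⟩
    exact (hray u (by simpa using hu) t ht).1 htu
  · intro hx
    have key : ∀ u : 𝔼, ‖u‖ = 1 → x = ‖x‖ • u → x ∈ lyzEllipsoid K := fun u hu hxu =>
      ⟨u, by simpa using hu, ‖x‖, norm_nonneg x,
        (hray u hu _ (norm_nonneg x)).2 (by rwa [← hxu]), hxu⟩
    rcases eq_or_ne x 0 with rfl | hx0
    -- The origin needs some unit vector as its direction, which exists because n ≥ 1.
    · exact key (EuclideanSpace.single ⟨0, hn⟩ 1) (by simp) (by simp)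
    · have hxn := norm_ne_zero_iff.2 hx0
      refine key (‖x‖⁻¹ • x) ?_ ?_
      · rw [norm_smul, norm_inv, norm_norm, inv_mul_cancel₀ hxn]
      · rw [smul_smul, mul_inv_cancel₀ hxn, one_smul]

theorem gauge_lyzEllipsoid_sq (hn : 1 ≤ n) (hK : (0 : 𝔼) ∈ interior (K : Set 𝔼)) (x : 𝔼) :
    gauge (lyzEllipsoid K) x ^ 2 = lyzForm K x := by
  -- The origin is treated apart: there the admissible r form the open ray (0, ∞) and not a closed
  -- ray starting at the root of the form.
  rcases eq_or_ne x 0 with rfl | hx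
  · have := lyzForm_smul (K := K) 0 0
    rw [smul_zero] at this
    rw [this, gauge_zero]
    ring
  · have hq := lyzForm_pos hn hK hx
    have hset : {r ∈ Ioi (0 : ℝ) | r⁻¹ • x ∈ lyzEllipsoid K} = Ici √(lyzForm K x) := by
      ext r
      have hiff : 0 < r → (r⁻¹ • x ∈ lyzEllipsoid K ↔ √(lyzForm K x) ≤ r) := by
        intro hr
        rw [mem_lyzEllipsoid_iff hn hK, lyzForm_smul, Real.sqrt_le_left hr.le, inv_pow,
          inv_mul_le_iff₀ (by positivity), mul_one]
      constructor
      · rintro ⟨hr, h⟩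
        exact (hiff hr).1 h
      · intro h
        have hr : 0 < r := (Real.sqrt_pos.2 hq).trans_le h
        exact ⟨hr, (hiff hr).2 h⟩
    rw [gauge_def', hset, csInf_Ici, Real.sq_sqrt hq.le]

end Ellipsoid

end LYZ

/-- `gauge L x` is the Minkowski functional `‖x‖_L`. The first three conjuncts say that the integrals
which define the two ellipsoids converge and that the radial function of `Γ₋₂K` is positive and
finite; the last one is the identity of the two ellipsoids. -/
theorem mainTheorem3 (n : ℕ) (hn : 1 ≤ n) (K : ConvexBody (EuclideanSpace ℝ (Fin n)))
    (hK : (0 : EuclideanSpace ℝ (Fin n)) ∈ interior (K : Set (EuclideanSpace ℝ (Fin n))))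
    (f : EuclideanSpace ℝ (Fin n) → ℝ)
    (hf : ∀ x, f x = Real.exp (-(gauge (K : Set (EuclideanSpace ℝ (Fin n))) x ^ 2 / 2))) :
    (MeasureTheory.Integrable f MeasureTheory.volume ∧ 0 < LYZ.totalMass f) ∧
    (∀ x : EuclideanSpace ℝ (Fin n),
      MeasureTheory.Integrable (LYZ.lyzIntegrand f x) (LYZ.functionSurfaceMeasure f)) ∧
    (∀ u ∈ Metric.sphere (0 : EuclideanSpace ℝ (Fin n)) 1,
      MeasureTheory.IntegrableOn (fun v => |⟪u, v⟫| ^ 2) (Metric.sphere 0 1)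
        (LYZ.surfaceAreaMeasureTwo K) ∧
      0 < ∫ v in Metric.sphere 0 1, |⟪u, v⟫| ^ 2 ∂(LYZ.surfaceAreaMeasureTwo K)) ∧
    ∀ x : EuclideanSpace ℝ (Fin n),
      LYZ.functionalLYZ f x = Real.exp (-(gauge (LYZ.lyzEllipsoid K) x ^ 2 / 2)) := by
  refine ⟨⟨LYZ.integrable_function hK hf, ?_⟩, LYZ.integrable_lyzIntegrand hn hK hf,
    fun u hu => ⟨LYZ.integrableOn_inner_sq hn hK u, LYZ.setIntegral_inner_sq_pos hn hK ?_⟩,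
    fun x => ?_⟩
  · rw [LYZ.totalMass_eq hK hf]
    exact mul_pos (LYZ.gaussianMoment_toReal_pos n) (LYZ.volume_real_pos hK)
  · rintro rfl
    simp at hu
  · rw [LYZ.functionalLYZ, LYZ.neg_log_functionalLYZ hn hK hf, LYZ.gauge_lyzEllipsoid_sq hn hK]
    rfl
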